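/- Notation: $\mathrm{He}\{Y\}=Y+Y^\top$; $M\succ0$ ($M\prec0$) means symmetric positive (negative) definite; $\star$ stands for blocks determined by symmetry; $\mathrm{diag}$ is block-diagonal; $\mathbb S_k^+$ is the set of symmetric positive definite $k\times k$ real matrices; scalars inside block patterns stand for multiples of the identity. Let $A_p\in\mathbb R^{n_p\times n_p}$, $B_p\in\mathbb R^{n_p\times m}$, $n=2n_p$, and let $1\le d_m\le d_n\le d_M$ be integers. Put $d_{m_1}=d_m$, $d_{M_1}=d_{m_2}=d_n$, $d_{M_2}=d_M$, $d_{\Delta_j}=d_{M_j}-d_{m_j}$, $D=d_M-d_n$, and $\gamma(1)=1$, $\gamma(d)=(d+1)/(d-1)$ for $d>1$. Fix $\varepsilon\in\mathbb R$. Suppose there are $\bar P_1\in\mathbb S_{4n}^+$, $\bar P_2\in\mathbb S_{3n}^+$; $\bar Q_{1_j},\bar Q_{2_j},\bar Z_{1_j},\bar Z_{2_j}\in\mathbb S_n^+$ and $\bar X_j\in\mathbb R^{2n\times2n}$ for $j=1,2$; $\bar Q_3,\bar Z_3\in\mathbb S_n^+$; $U\in\mathbb R^{n_p\times n_p}$,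 $J=\mathrm{diag}(U,U)$; $\bar K,\bar F\in\mathbb R^{m\times n_p}$, $\bar L\in\mathbb R^{n_p\times n_p}$, such that, for $j=1,2$, $$\bar\Psi_j\succ0,\qquad \bar\Phi(d_{m_j},j)+\bar\Upsilon_j\prec0,\qquad \bar\Phi(d_{M_j},j)+\bar\Upsilon_j\prec0,\tag{1}$$ $$\mathrm{diag}(\bar S_1,0_n)-\mathrm{diag}(0_n,\bar S_2)+\mathrm{He}\{\mathcal I^\top\bar{\mathcal L}(l)\}\prec0\quad(l=d_m,\dots,d_n),\tag{2}$$ $$\mathrm{diag}(\bar S_2,0_n)-\mathrm{diag}(0_n,\bar S_1)+\mathrm{He}\{\mathcal I^\top\bar{\mathcal L}(l)\}\prec0\quad(l=d_n,\dots,d_M).\tag{3}$$ The matrices in (1)–(3) are the following. Let $$\bar A=\begin{bmatrix}A_pU^\top+B_p\bar K&-B_p\bar K\\0&A_pU^\top\end{bmatrix},\quad \bar A_d=\begin{bmatrix}B_p\bar F&0\\-\bar L&0\end{bmatrix},\quad \bar A_n=\begin{bmatrix}-B_p\bar F&B_p\bar F\\\bar L&-\bar L\end{bmatrix},$$ $\bar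 A_{m_1}=0$, $\bar A_{M_1}=\bar A_n$, $\bar A_{m_2}=\bar A_n$, $\bar A_{M_2}=0$. Then $\bar\Upsilon_j=\mathrm{diag}(\bar\Upsilon_{a_j},0)$, with zero block of size $5n$ for $j=1$ and $3n$ for $j=2$, and $$\bar\Upsilon_{a_j}=\begin{bmatrix}-J-J^\top&\bar A-\varepsilon J&\bar A_{m_j}&\bar A_d&\bar A_{M_j}\\ \star&\varepsilon(\bar A+\bar A^\top)&\varepsilon\bar A_{m_j}&\varepsilon\bar A_d&\varepsilon\bar A_{M_j}\\ \star&\star&0&0&0\\ \star&\star&\star&0&0\\ \star&\star&\star&\star&0\end{bmatrix}.$$ Further, $\bar\Psi_j=\begin{bmatrix}\mathscr Z_{2_j}&\bar X_j\\ \star&\mathscr Z_{2_j}\end{bmatrix}$ with $\mathscr Z_{2_j}=\mathrm{diag}(\bar Z_{2_j},3\bar Z_{2_j})$, and $$\bar\Phi(d,j)=W_{2_j}^\top\bar P_jW_{2_j}-W_{1_j}^\top\bar P_jW_{1_j}+\mathrm{He}\{W_j(d)^\top\bar P_j(W_{2_j}-W_{1_j})\}+\mathcal Q_j+W_{3_j}^\top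 N_jW_{3_j}-W_{s_j}^\top\mathrm{diag}(\bar Z_{1_j},3\gamma(d_{m_j})\bar Z_{1_j})W_{s_j}-W_{\Psi_j}^\top\bar\Psi_jW_{\Psi_j}-R_j,$$ where $N_1=d_{m_1}^2\bar Z_{1_1}+d_{\Delta_1}^2\bar Z_{2_1}+D^2\bar Z_3$, $N_2=d_{m_2}^2\bar Z_{1_2}+d_{\Delta_2}^2\bar Z_{2_2}$, $R_1=W_z^\top\mathrm{diag}(\bar Z_3,3\bar Z_3)W_z$, $R_2=0$, $\mathcal Q_1=\mathrm{diag}(0,\bar Q_{1_1},\bar Q_{2_1}-\bar Q_{1_1},0,\bar Q_3-\bar Q_{2_1},0_{5n})$, $\mathcal Q_2=\mathrm{diag}(0,\bar Q_{1_2},\bar Q_{2_2}-\bar Q_{1_2},0,-\bar Q_{2_2},0_{3n})$. For $j=2$, with $a=d_{m_2}$, $b=d_{M_2}$, $$W_{1_2}=\begin{bmatrix}0&1&0&0&0&0&0&0\\0&-1&0&0&0&a+1&0&0\\0&0&-1&-1&0&0&1-a&b+1\end{bmatrix},\quad W_{2_2}=\begin{bmatrix}1&0&0&0&0&0&0&0\\0&0&-1&0&0&a+1&0&0\\0&0&0&-1&-1&0&1-a&b+1\end{bmatrix},$$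 $W_2(d)$ has third block row $[0\ 0\ 0\ 0\ 0\ 0\ d\ {-d}]$ and its other rows are zero, $W_{3_2}=[1\ {-1}\ 0\ 0\ 0\ 0\ 0\ 0]$, $$W_{s_2}=\begin{bmatrix}0&1&-1&0&0&0&0&0\\0&1&1&0&0&-2&0&0\end{bmatrix},\qquad W_{\Psi_2}=\begin{bmatrix}0&0&0&1&-1&0&0&0\\0&0&0&1&1&0&0&-2\\0&0&1&-1&0&0&0&0\\0&0&1&1&0&0&-2&0\end{bmatrix}.$$ For $j=1$ the same matrices, now with $a=d_{m_1}$, $b=d_{M_1}$, get two zero block columns on the right, and $W_{1_1},W_{2_1},W_1(d)$ get as fourth block row $[0\ 0\ 0\ 0\ {-1}\ 0\ 0\ 0\ 0\ D{+}1]$, $[0\ 0\ 0\ 0\ 0\ 0\ 0\ 0\ {-1}\ D{+}1]$ and $0$, respectively; $W_z=\begin{bmatrix}0&0&0&0&1&0&0&0&-1&0\\0&0&0&0&1&0&0&0&1&-2\end{bmatrix}$. With block columns indexed by $0,1,\dots,d_M+1$ (standing for $x(k+1),x(k),\dots,x(k-d_M)$), $\mathcal I=[I\ \varepsilon I\ 0\cdots0]$,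 and $\bar{\mathcal L}(l)$ is the block row that is the sum of $-J^\top$ in column $0$, $\bar A$ in column $1$, $\bar A_n$ in column $d_n+1$ and $\bar A_d$ in column $l+1$. Finally $\bar S_j=W_{5_j}^\top\bar P_jW_{5_j}+\mathcal P_j$, with block rows and columns indexed by $0,\dots,d_M$. Here $W_{5_j}$ has block rows with identity blocks exactly in the columns $\{0\}$, $\{1,\dots,d_{m_j}\}$, $\{d_{m_j}+1,\dots,d_{M_j}\}$ and, for $j=1$ only, a fourth one with $\{d_n+1,\dots,d_M\}$; and $\mathcal P_1=\mathrm{diag}(\mathcal H_1,\bar Q_3,\dots,\bar Q_3)+\mathcal H_a$ ($\bar Q_3$ repeated $D$ times), $\mathcal P_2=\mathcal H_2$. The matrices $\mathcal H_j$ ($d_{M_j}+1$ block rows) and $\mathcal H_a$ ($d_M+1$ block rows) are symmetric block tridiagonal. $\mathcal H_j$ has diagonal blocks $\bar Z_{1_j}d_{m_j}^2+\bar Z_{2_j}d_{\Delta_j}^2$ at $0$; $\bar Q_{1_j}+2d_{\Delta_j}^2\bar Z_{2_j}+d_{m_j}(2d_{m_j}-2i+1)\bar Z_{1_j}$ at $1\le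 i\le d_{m_j}$; $\bar Q_{2_j}+d_{\Delta_j}(2d_{\Delta_j}-2l+1)\bar Z_{2_j}$ at $d_{m_j}+l$, $1\le l\le d_{\Delta_j}$; and superdiagonal blocks $-d_{\Delta_j}^2\bar Z_{2_j}-d_{m_j}(d_{m_j}-i+1)\bar Z_{1_j}$ at $(i-1,i)$, $1\le i\le d_{m_j}$; $-d_{\Delta_j}(d_{\Delta_j}-l+1)\bar Z_{2_j}$ at $(d_{m_j}+l-1,d_{m_j}+l)$, $1\le l\le d_{\Delta_j}$. $\mathcal H_a$ has diagonal blocks $D^2\bar Z_3$ at $0$; $2D^2\bar Z_3$ at $1\le i\le d_n$; $D(2D-2l+1)\bar Z_3$ at $d_n+l$, $1\le l\le D$; and superdiagonal blocks $-D^2\bar Z_3$ at $(i-1,i)$, $1\le i\le d_n$; $-D(D-l+1)\bar Z_3$ at $(d_n+l-1,d_n+l)$, $1\le l\le D$. Then $U$ is invertible, and with the gains $K=\bar KU^{-\top}$, $F=\bar FU^{-\top}$, $L=\bar LU^{-\top}$ the closed loop of the plant $$x_p(k+1)=A_px_p(k)+B_pu(k),\qquad y(k)=x_p(k-d(k))$$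 and the observer-based controller $$\hat x_p(k+1)=A_p\hat x_p(k)+B_pu(k)+Le_y(k),\quad u(k)=K\hat x_p(k)+Fe_y(k),\quad e_y(k)=y(k)-\hat x_p(k-d_n),$$ equivalently, with $x=(x_p,\,x_p-\hat x_p)$, the system $x(k+1)=Ax(k)+A_nx(k-d_n)+A_dx(k-d(k))$ with $$A=\begin{bmatrix}A_p+B_pK&-B_pK\\0&A_p\end{bmatrix},\quad A_d=\begin{bmatrix}B_pF&0\\-L&0\end{bmatrix},\quad A_n=\begin{bmatrix}-B_pF&B_pF\\L&-L\end{bmatrix},$$ is asymptotically stable (Lyapunov stable with respect to initial conditions on $[-d_M,0]$, and all solutions tend to $0$) for every time-varying delay $d:\mathbb N\to\{d_m,\dots,d_M\}$. -/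

import Mathlib

open Filter Topology
open scoped Matrix Kronecker

noncomputable section

namespace DelayLMI

/-! ### Block matrices -/

/-- Flatten a matrix whose entries are matrices into an ordinary real matrix. -/
def flat {a b ι κ : Type*} (M : Matrix a b (Matrix ι κ ℝ)) : Matrix (a × ι) (b × κ) ℝ :=
  Matrix.of fun p q => M p.1 q.1 p.2 q.2

/-- The block matrix whose `(i, k)` block is `w i k` times the identity. -/
def scal {a b : Type*} (ι : Type*) [DecidableEq ι] (w : Matrix a b ℝ) :
    Matrix (a × ι) (b × ι) ℝ :=
  w ⊗ₖ (1 : Matrix ι ι ℝ)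

/-- `He{Y} = Y + Yᵀ`. -/
def He {a : Type*} (Y : Matrix a a ℝ) : Matrix a a ℝ := Y + Yᵀ

/-- `M ≺ 0`: the symmetric matrix `M` is negative definite. -/
def NegDef {a : Type*} (M : Matrix a a ℝ) : Prop := (-M).PosDef

/-- A `5 × 5` block matrix extended to a `c × c` block matrix by zero blocks. -/
def padZero {R : Type*} [Zero R] (c : ℕ) (M : Matrix (Fin 5) (Fin 5) R) :
    Matrix (Fin c) (Fin c) R :=
  Matrix.of fun p q =>
    if h : (p : ℕ) < 5 ∧ (q : ℕ) < 5 then M ⟨p, h.1⟩ ⟨q, h.2⟩ else 0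

/-- `diag(S, 0)`: one zero block is appended at the end. -/
def diagLast {R : Type*} [Zero R] {N : ℕ} (S : Matrix (Fin N) (Fin N) R) :
    Matrix (Fin (N + 1)) (Fin (N + 1)) R :=
  Matrix.of fun p q =>
    if h : (p : ℕ) < N ∧ (q : ℕ) < N then S ⟨p, h.1⟩ ⟨q, h.2⟩ else 0

/-- `diag(0, S)`: one zero block is put in front. -/
def diagFirst {R : Type*} [Zero R] {N : ℕ} (S : Matrix (Fin N) (Fin N) R) :
    Matrix (Fin (N + 1)) (Fin (N + 1)) R :=
  Matrix.of fun p q => if h : p ≠ 0 ∧ q ≠ 0 then S (p.pred h.1) (q.pred h.2) else 0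

/-! ### Delay systems and asymptotic stability -/

/-- `x` solves `x(k+1) = A x(k) + Aₙ x(k - dₙ) + A_d x(k - d(k))` for all `k ≥ 0`; the values
`x(k)` with `k ≤ 0` are the initial condition. -/
def IsSolution {ι : Type*} [Fintype ι] (A An Ad : Matrix ι ι ℝ) (dn : ℕ) (d : ℕ → ℕ)
    (x : ℤ → ι → ℝ) : Prop :=
  ∀ k : ℕ, x ((k : ℤ) + 1) =
    A *ᵥ x (k : ℤ) + An *ᵥ x ((k : ℤ) - (dn : ℤ)) + Ad *ᵥ x ((k : ℤ) - (d k : ℤ))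

/-- Asymptotic stability of the delay system: Lyapunov stability of the origin with respect to
initial conditions on `[-d_M, 0]`, and convergence to the origin of every solution. -/
def AsympStable {ι : Type*} [Fintype ι] (A An Ad : Matrix ι ι ℝ) (dn dM : ℕ) (d : ℕ → ℕ) :
    Prop :=
  (∀ r : ℝ, 0 < r → ∃ δ : ℝ, 0 < δ ∧ ∀ x : ℤ → ι → ℝ, IsSolution A An Ad dn d x →
      (∀ i : ℕ, i ≤ dM → ‖x (-(i : ℤ))‖ < δ) → ∀ k : ℕ, ‖x (k : ℤ)‖ < r) ∧
    ∀ x : ℤ → ι → ℝ, IsSolution A An Ad dn d x →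
      Tendsto (fun k : ℕ => x (k : ℤ)) atTop (𝓝 0)

/-- `x_p`, `x̂_p` are the plant and observer states of the loop formed by the plant
`x_p(k+1) = A_p x_p(k) + B_p u(k)`, `y(k) = x_p(k - d(k))` and the observer-based controller
`x̂_p(k+1) = A_p x̂_p(k) + B_p u(k) + L e_y(k)`, `u(k) = K x̂_p(k) + F e_y(k)`,
`e_y(k) = y(k) - x̂_p(k - dₙ)`. -/
def IsLoopSolution {p q : Type*} [Fintype p] [Fintype q] (Ap : Matrix p p ℝ) (Bp : Matrix p q ℝ)
    (K F : Matrix q p ℝ) (L : Matrix p p ℝ) (dn : ℕ) (d : ℕ → ℕ) (xp xh : ℤ → p → ℝ) : Prop :=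
  ∃ (u : ℕ → q → ℝ) (y ey : ℕ → p → ℝ), ∀ k : ℕ,
    xp ((k : ℤ) + 1) = Ap *ᵥ xp (k : ℤ) + Bp *ᵥ u k ∧
    y k = xp ((k : ℤ) - (d k : ℤ)) ∧
    xh ((k : ℤ) + 1) = Ap *ᵥ xh (k : ℤ) + Bp *ᵥ u k + L *ᵥ ey k ∧
    u k = K *ᵥ xh (k : ℤ) + F *ᵥ ey k ∧
    ey k = y k - xh ((k : ℤ) - (dn : ℤ))

/-- Asymptotic stability of the plant-observer-controller loop, in the states `(x_p, x̂_p)`. -/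
def LoopAsympStable {p q : Type*} [Fintype p] [Fintype q] (Ap : Matrix p p ℝ)
    (Bp : Matrix p q ℝ) (K F : Matrix q p ℝ) (L : Matrix p p ℝ) (dn dM : ℕ) (d : ℕ → ℕ) : Prop :=
  (∀ r : ℝ, 0 < r → ∃ δ : ℝ, 0 < δ ∧ ∀ xp xh : ℤ → p → ℝ,
      IsLoopSolution Ap Bp K F L dn d xp xh →
      (∀ i : ℕ, i ≤ dM → ‖xp (-(i : ℤ))‖ < δ ∧ ‖xh (-(i : ℤ))‖ < δ) →
      ∀ k : ℕ, ‖xp (k : ℤ)‖ < r ∧ ‖xh (k : ℤ)‖ < r) ∧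
    ∀ xp xh : ℤ → p → ℝ, IsLoopSolution Ap Bp K F L dn d xp xh →
      Tendsto (fun k : ℕ => xp (k : ℤ)) atTop (𝓝 0) ∧
      Tendsto (fun k : ℕ => xh (k : ℤ)) atTop (𝓝 0)

/-! ### Closed-loop matrices, in the state `x = (x_p, e)` with `e = x_p - x̂_p` -/

section ClosedLoop

variable {p q : Type*} [Fintype p] [Fintype q]

/-- `[[A_p + B_p K, -B_p K], [0, A_p]]`. -/
def clA (Ap : Matrix p p ℝ) (Bp : Matrix p q ℝ) (K : Matrix q p ℝ) :
    Matrix (p ⊕ p) (p ⊕ p) ℝ :=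
  Matrix.fromBlocks (Ap + Bp * K) (-(Bp * K)) 0 Ap

/-- `[[B_p F, 0], [-L, 0]]`. -/
def clAd (Bp : Matrix p q ℝ) (F : Matrix q p ℝ) (L : Matrix p p ℝ) :
    Matrix (p ⊕ p) (p ⊕ p) ℝ :=
  Matrix.fromBlocks (Bp * F) 0 (-L) 0

/-- `[[-B_p F, B_p F], [L, -L]]`. -/
def clAn (Bp : Matrix p q ℝ) (F : Matrix q p ℝ) (L : Matrix p p ℝ) :
    Matrix (p ⊕ p) (p ⊕ p) ℝ :=
  Matrix.fromBlocks (-(Bp * F)) (Bp * F) L (-L)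

/-- `Ā = [[A_p Uᵀ + B_p K̄, -B_p K̄], [0, A_p Uᵀ]]`. The matrices `Ā_d`, `Ā_n` are
`clAd Bp F̄ L̄` and `clAn Bp F̄ L̄`. -/
def barA (Ap : Matrix p p ℝ) (Bp : Matrix p q ℝ) (U : Matrix p p ℝ) (Kb : Matrix q p ℝ) :
    Matrix (p ⊕ p) (p ⊕ p) ℝ :=
  Matrix.fromBlocks (Ap * Uᵀ + Bp * Kb) (-(Bp * Kb)) 0 (Ap * Uᵀ)

/-- `J = diag(U, U)`. -/
def matJ (U : Matrix p p ℝ) : Matrix (p ⊕ p) (p ⊕ p) ℝ := Matrix.fromBlocks U 0 0 U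

end ClosedLoop

/-! ### The auxiliary matrices

The block columns correspond to
`x(k+1), x(k), x(k-d_m), x(k-d(k)), x(k-d_M), v₁, v₂, v₃` in the second mode (8 blocks), followed
by two more blocks in the first mode. -/

/-- `γ(1) = 1`, `γ(d) = (d+1)/(d-1)` for `d > 1`. -/
def gam (d : ℕ) : ℝ := if d = 1 then 1 else ((d : ℝ) + 1) / ((d : ℝ) - 1)

/-- `W₁(d_m, d_M)`. -/
def w1 (dm dM : ℝ) : Matrix (Fin 3) (Fin 8) ℝ :=
  !![0,  1,  0,  0, 0,      0,      0,      0;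
     0, -1,  0,  0, 0, dm + 1,      0,      0;
     0,  0, -1, -1, 0,      0, 1 - dm, dM + 1]

/-- `W₂(d_m, d_M)`. -/
def w2 (dm dM : ℝ) : Matrix (Fin 3) (Fin 8) ℝ :=
  !![1, 0,  0,  0,  0,      0,      0,      0;
     0, 0, -1,  0,  0, dm + 1,      0,      0;
     0, 0,  0, -1, -1,      0, 1 - dm, dM + 1]

/-- `W(d)`. -/
def wd (d : ℝ) : Matrix (Fin 3) (Fin 8) ℝ :=
  !![0, 0, 0, 0, 0, 0, 0,  0;
     0, 0, 0, 0, 0, 0, 0,  0;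
     0, 0, 0, 0, 0, 0, d, -d]

/-- `W₃`. -/
def w3 : Matrix (Fin 1) (Fin 8) ℝ := !![1, -1, 0, 0, 0, 0, 0, 0]

/-- `W_s = [M 0]`. -/
def ws : Matrix (Fin 2) (Fin 8) ℝ :=
  !![0, 1, -1, 0, 0,  0, 0, 0;
     0, 1,  1, 0, 0, -2, 0, 0]

/-- The upper half `[0 0 M]` of `W_Ψ`. -/
def wPsiTop : Matrix (Fin 2) (Fin 8) ℝ :=
  !![0, 0, 0, 1, -1, 0, 0,  0;
     0, 0, 0, 1,  1, 0, 0, -2]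

/-- The lower half `[0 M 0]` of `W_Ψ`. -/
def wPsiBot : Matrix (Fin 2) (Fin 8) ℝ :=
  !![0, 0, 1, -1, 0, 0,  0, 0;
     0, 0, 1,  1, 0, 0, -2, 0]

/-- Two zero block columns appended on the right (first mode). -/
def ext {a : Type*} (w : Matrix a (Fin 8) ℝ) : Matrix a (Fin 10) ℝ :=
  Matrix.of fun i k => if h : (k : ℕ) < 8 then w i ⟨k, h⟩ else 0

/-- `W_{1_1}`, with `D = d_M - d_{M_1}`: the rows of `W₁` and one more row. -/
def w1One (dm dM D : ℝ) : Matrix (Fin 4) (Fin 10) ℝ :=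
  !![0,  1,  0,  0,  0,      0,      0,      0, 0,     0;
     0, -1,  0,  0,  0, dm + 1,      0,      0, 0,     0;
     0,  0, -1, -1,  0,      0, 1 - dm, dM + 1, 0,     0;
     0,  0,  0,  0, -1,      0,      0,      0, 0, D + 1]

/-- `W_{2_1}`, with `D = d_M - d_{M_1}`: the rows of `W₂` and one more row. -/
def w2One (dm dM D : ℝ) : Matrix (Fin 4) (Fin 10) ℝ :=
  !![1, 0,  0,  0,  0,      0,      0,      0,  0,     0;
     0, 0, -1,  0,  0, dm + 1,      0,      0,  0,     0;
     0, 0,  0, -1, -1,      0, 1 - dm, dM + 1,  0,     0;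
     0, 0,  0,  0,  0,      0,      0,      0, -1, D + 1]

/-- `W_1(d)` for the first mode: the rows of `W(d)` and a zero row. -/
def wdOne (d : ℝ) : Matrix (Fin 4) (Fin 10) ℝ :=
  !![0, 0, 0, 0, 0, 0, 0,  0, 0, 0;
     0, 0, 0, 0, 0, 0, 0,  0, 0, 0;
     0, 0, 0, 0, 0, 0, d, -d, 0, 0;
     0, 0, 0, 0, 0, 0, 0,  0, 0, 0]

/-- `W_z`. -/
def wz : Matrix (Fin 2) (Fin 10) ℝ :=
  !![0, 0, 0, 0, 1, 0, 0, 0, -1,  0;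
     0, 0, 0, 0, 1, 0, 0, 0,  1, -2]

section LMI

variable {ι : Type*} [Fintype ι] [DecidableEq ι]

/-- `diag(Z, c Z)`. -/
def diagZ (c : ℝ) (Z : Matrix ι ι ℝ) : Matrix (Fin 2 × ι) (Fin 2 × ι) ℝ :=
  flat (Matrix.diagonal ![Z, c • Z])

/-- `Ψ_z = [[diag(Z₂, 3Z₂), X], [⋆, diag(Z₂, 3Z₂)]]`. -/
def psiZ (Z2 : Matrix ι ι ℝ) (X : Matrix (Fin 2 × ι) (Fin 2 × ι) ℝ) :
    Matrix ((Fin 2 × ι) ⊕ (Fin 2 × ι)) ((Fin 2 × ι) ⊕ (Fin 2 × ι)) ℝ :=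
  Matrix.fromBlocks (diagZ 3 Z2) X Xᵀ (diagZ 3 Z2)

/-- `W_Ψ`, from the scalar patterns of its two halves. -/
def wPsi {b : Type*} (ι : Type*) [DecidableEq ι] (t l : Matrix (Fin 2) b ℝ) :
    Matrix ((Fin 2 × ι) ⊕ (Fin 2 × ι)) (b × ι) ℝ :=
  Matrix.fromRows (scal ι t) (scal ι l)

/-- `Φ₁ = W₂ᵀ P W₂ - W₁ᵀ P W₁ + He{Wᵀ P (W₂ - W₁)}`. -/
def phiOne {a b : Type*} [Fintype a] (P : Matrix (a × ι) (a × ι) ℝ) (v1 v2 v : Matrix a b ℝ) :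
    Matrix (b × ι) (b × ι) ℝ :=
  (scal ι v2)ᵀ * P * scal ι v2 - (scal ι v1)ᵀ * P * scal ι v1 +
    He ((scal ι v)ᵀ * P * (scal ι v2 - scal ι v1))

/-- `Φ(d, 1)` in terms of the decision matrices of the first mode, whose delay bounds are
`dm ≤ dn`; `dM` is the maximal delay of the whole system. -/
def phiMode1 (dm dn dM : ℕ) (P : Matrix (Fin 4 × ι) (Fin 4 × ι) ℝ)
    (Q1 Q2 Q3 Z1 Z2 Z3 : Matrix ι ι ℝ) (X : Matrix (Fin 2 × ι) (Fin 2 × ι) ℝ) (d : ℕ) :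
    Matrix (Fin 10 × ι) (Fin 10 × ι) ℝ :=
  phiOne P (w1One dm dn ((dM : ℝ) - dn)) (w2One dm dn ((dM : ℝ) - dn)) (wdOne d) +
    flat (Matrix.diagonal ![0, Q1, Q2 - Q1, 0, Q3 - Q2, 0, 0, 0, 0, 0]) +
    ((scal ι (ext w3))ᵀ *
        flat (Matrix.diagonal ![(dm : ℝ) ^ 2 • Z1 + ((dn : ℝ) - dm) ^ 2 • Z2 +
          ((dM : ℝ) - dn) ^ 2 • Z3]) * scal ι (ext w3) -
      (scal ι (ext ws))ᵀ * diagZ (3 * gam dm) Z1 * scal ι (ext ws) -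
      (wPsi ι (ext wPsiTop) (ext wPsiBot))ᵀ * psiZ Z2 X * wPsi ι (ext wPsiTop) (ext wPsiBot) -
      (scal ι wz)ᵀ * diagZ 3 Z3 * scal ι wz)

/-- `Φ(d, 2)` in terms of the decision matrices of the second mode, whose delay bounds are
`dn ≤ dM`. -/
def phiMode2 (dn dM : ℕ) (P : Matrix (Fin 3 × ι) (Fin 3 × ι) ℝ)
    (Q1 Q2 Z1 Z2 : Matrix ι ι ℝ) (X : Matrix (Fin 2 × ι) (Fin 2 × ι) ℝ) (d : ℕ) :
    Matrix (Fin 8 × ι) (Fin 8 × ι) ℝ :=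
  phiOne P (w1 dn dM) (w2 dn dM) (wd d) +
    flat (Matrix.diagonal ![0, Q1, Q2 - Q1, 0, -Q2, 0, 0, 0]) +
    ((scal ι w3)ᵀ *
        flat (Matrix.diagonal ![(dn : ℝ) ^ 2 • Z1 + ((dM : ℝ) - dn) ^ 2 • Z2]) * scal ι w3 -
      (scal ι ws)ᵀ * diagZ (3 * gam dn) Z1 * scal ι ws -
      (wPsi ι wPsiTop wPsiBot)ᵀ * psiZ Z2 X * wPsi ι wPsiTop wPsiBot)

/-- `Ῡ_j = diag(Ῡ_{a_j}, 0)` with `c` block rows (`c = 10` for `j = 1`, `c = 8` for `j = 2`). -/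
def upsilon (c : ℕ) (ε : ℝ) (J A Am Ad AM : Matrix ι ι ℝ) :
    Matrix (Fin c × ι) (Fin c × ι) ℝ :=
  flat (padZero c
    !![-J - Jᵀ,       A - ε • J,       Am,     Ad,     AM;
       (A - ε • J)ᵀ,  ε • A + ε • Aᵀ,  ε • Am, ε • Ad, ε • AM;
       Amᵀ,           (ε • Am)ᵀ,       0,      0,      0;
       Adᵀ,           (ε • Ad)ᵀ,       0,      0,      0;
       AMᵀ,           (ε • AM)ᵀ,       0,      0,      0])

/-! ### The matrices `S_j` of the functionals on the whole history `x(k), …, x(k-d_M)` -/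

/-- `W_{5_1}`: it maps the history to `x(k)` and the sums of `x(k-i)` over `1 ≤ i ≤ dm`,
`dm < i ≤ dn`, `dn < i ≤ dM`. -/
def w5One (dm dn dM : ℕ) : Matrix (Fin 4) (Fin (dM + 1)) ℝ :=
  Matrix.of
    ![fun i => if (i : ℕ) = 0 then 1 else 0,
      fun i => if 1 ≤ (i : ℕ) ∧ (i : ℕ) ≤ dm then 1 else 0,
      fun i => if dm < (i : ℕ) ∧ (i : ℕ) ≤ dn then 1 else 0,
      fun i => if dn < (i : ℕ) then 1 else 0]

/-- `W_{5_2}`: it maps the history to `x(k)` and the sums of `x(k-i)` over `1 ≤ i ≤ dn`,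
`dn < i ≤ dM`. -/
def w5Two (dn dM : ℕ) : Matrix (Fin 3) (Fin (dM + 1)) ℝ :=
  Matrix.of
    ![fun i => if (i : ℕ) = 0 then 1 else 0,
      fun i => if 1 ≤ (i : ℕ) ∧ (i : ℕ) ≤ dn then 1 else 0,
      fun i => if dn < (i : ℕ) then 1 else 0]

/-- The block tridiagonal format of `H_j`, with rows and columns numbered from `0`: the diagonal
is `P₀, P_{a_1}, …, P_{a_m}, P_{c_1}, P_{c_2}, …`, the superdiagonal is
`P_{b_1}, …, P_{b_m}, P_{d_1}, P_{d_2}, …`, and the rest is filled in by symmetry. -/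
def hFormat (m : ℕ) (P0 : Matrix ι ι ℝ) (Pa Pb Pc Pd : ℕ → Matrix ι ι ℝ) (i k : ℕ) :
    Matrix ι ι ℝ :=
  if i = k then (if i = 0 then P0 else if i ≤ m then Pa i else Pc (i - m))
  else if k = i + 1 then (if k ≤ m then Pb k else Pd (k - m))
  else if i = k + 1 then (if i ≤ m then Pb i else Pd (i - m))ᵀ
  else 0

/-- The blocks of `H_j`, for a mode with delay bounds `a ≤ b`. -/
def hMat (a b : ℕ) (Q1 Q2 Z1 Z2 : Matrix ι ι ℝ) : ℕ → ℕ → Matrix ι ι ℝ :=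
  let Δ : ℝ := (b : ℝ) - a
  hFormat a ((a : ℝ) ^ 2 • Z1 + Δ ^ 2 • Z2)
    (fun i => Q1 + (2 * Δ ^ 2) • Z2 + ((a : ℝ) * (2 * a - 2 * i + 1)) • Z1)
    (fun i => -(Δ ^ 2 • Z2) - ((a : ℝ) * (a - i + 1)) • Z1)
    (fun l => Q2 + (Δ * (2 * Δ - 2 * l + 1)) • Z2)
    (fun l => -((Δ * (Δ - l + 1)) • Z2))

/-- The blocks of `H_{a_1}`, where `b = d_{M_1}`. -/
def haMat (b dM : ℕ) (Z3 : Matrix ι ι ℝ) : ℕ → ℕ → Matrix ι ι ℝ :=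
  let Δ : ℝ := (dM : ℝ) - b
  hFormat b (Δ ^ 2 • Z3)
    (fun _ => (2 * Δ ^ 2) • Z3)
    (fun _ => -(Δ ^ 2 • Z3))
    (fun l => (Δ * (2 * Δ - 2 * l + 1)) • Z3)
    (fun l => -((Δ * (Δ - l + 1)) • Z3))

/-- `S_1 = W_{5_1}ᵀ P_1 W_{5_1} + diag(H_1, Q_3, …, Q_3) + H_{a_1}`. -/
def sOne (dm dn dM : ℕ) (P : Matrix (Fin 4 × ι) (Fin 4 × ι) ℝ)
    (Q1 Q2 Q3 Z1 Z2 Z3 : Matrix ι ι ℝ) :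
    Matrix (Fin (dM + 1) × ι) (Fin (dM + 1) × ι) ℝ :=
  (scal ι (w5One dm dn dM))ᵀ * P * scal ι (w5One dm dn dM) +
    flat (Matrix.of fun i k : Fin (dM + 1) =>
      (if (i : ℕ) ≤ dn ∧ (k : ℕ) ≤ dn then hMat dm dn Q1 Q2 Z1 Z2 i k
        else if i = k then Q3 else 0) + haMat dn dM Z3 i k)

/-- `S_2 = W_{5_2}ᵀ P_2 W_{5_2} + H_2`. -/
def sTwo (dn dM : ℕ) (P : Matrix (Fin 3 × ι) (Fin 3 × ι) ℝ) (Q1 Q2 Z1 Z2 : Matrix ι ι ℝ) :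
    Matrix (Fin (dM + 1) × ι) (Fin (dM + 1) × ι) ℝ :=
  (scal ι (w5Two dn dM))ᵀ * P * scal ι (w5Two dn dM) +
    flat (Matrix.of fun i k : Fin (dM + 1) => hMat dn dM Q1 Q2 Z1 Z2 i k)

/-- A flattened block matrix seen as a matrix of blocks. -/
def blocks {a b κ : Type*} (M : Matrix (a × ι) (b × κ) ℝ) : Matrix a b (Matrix ι κ ℝ) :=
  Matrix.of fun i k => Matrix.of fun r s => M (i, r) (k, s)

/-- `diag(S, 0_n) - diag(0_n, S')`. -/
def edge {N : ℕ} (S S' : Matrix (Fin N × ι) (Fin N × ι) ℝ) :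
    Matrix (Fin (N + 1) × ι) (Fin (N + 1) × ι) ℝ :=
  flat (diagLast (blocks S)) - flat (diagFirst (blocks S'))

/-- `𝓘 = [I, εI, 0, …, 0]`, with `dM + 2` blocks. -/
def multI (ι : Type*) [DecidableEq ι] (dM : ℕ) (ε : ℝ) :
    Matrix (Fin 1 × ι) (Fin (dM + 2) × ι) ℝ :=
  scal ι (Matrix.of fun _ i => if (i : ℕ) = 0 then 1 else if (i : ℕ) = 1 then ε else 0)

/-- `𝓛̄(l) = [-Jᵀ, Ā, 0, …, 0, Ā_n, 0, …, 0] + Ā_d [0, 0, δ(1) I, …, δ(d_M) I]`, with block columns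
for `x(k+1), x(k), x(k-1), …, x(k-dM)`; the block `Ā_n` stands in the column of `x(k-dn)`. -/
def barL (dn dM : ℕ) (J A An Ad : Matrix ι ι ℝ) (l : ℕ) :
    Matrix (Fin 1 × ι) (Fin (dM + 2) × ι) ℝ :=
  flat (Matrix.of fun (_ : Fin 1) (i : Fin (dM + 2)) =>
    (if (i : ℕ) = 0 then -Jᵀ else 0) + (if (i : ℕ) = 1 then A else 0) +
      (if (i : ℕ) = dn + 1 then An else 0) + (if (i : ℕ) = l + 1 then Ad else 0))

end LMI

end DelayLMI

end

open DelayLMI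

noncomputable section

set_option linter.unusedSectionVars false

namespace DelayLMI

/-! ### Quadratic forms -/

/-! The proof runs a Lyapunov argument for the minimum of two functionals, in coordinates that make
the gains disappear. Put x = Jᵀz. Since K Uᵀ = K̄, F Uᵀ = F̄ and L Uᵀ = L̄, the closed loop becomes
the implicit system Jᵀz(k+1) = Ā z(k) + Ā_n z(k-d_n) + Ā_d z(k-d(k)). Both Ῡ_j and the multiplier
term of the linking inequalities are twice the product of z(k+1) + εz(k) with the residual of this
equation, so they vanish along trajectories (`qf_upsilon`, `qf_multiplier_eq_zero`).

The functionals V₁ = `lyapOne` and V₂ = `lyapTwo` are forms in the same history z(k), …, z(k-d_M),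
with matrices S₁ and S₂ (`qf_sOne`, `qf_sTwo`). If d(k) ≤ d_n, the inequality for Φ(·, 1) gives
V₁(k+1) ≤ V₁(k) - c‖z(k)‖², and the first linking inequality gives V₁(k+1) ≤ V₂(k) - c‖z(k)‖². If
d(k) ≥ d_n, the same holds with the roles exchanged. So min(V₁, V₂) drops by at least c‖z(k)‖² at
every step, however the delay switches. Nonnegativity is then enough: telescoping bounds c ∑ ‖z(k)‖²
by the initial value, which yields stability and convergence together (`implicit_asympStable`).

That Φ bounds the increment of V_j (`lyapOne_sub_le`, `lyapTwo_sub_le`) rests on three facts.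
Shifting a weighted sum of increments leaves minus the energy over the delay range
(`incSum_sub_shift`). The discrete Wirtinger inequality bounds an energy from below by end values
and the average (`wirtinger`). For the range split at d(k), the two Wirtinger bounds combine through
Ψ by reciprocal convexity (`qf_psiZ_le`). As Φ(d, j) is affine in d, its values at the two ends of
the range suffice.

Finally, U is invertible because a kernel vector of Jᵀ placed in the block of z(k+1) would make a
negative definite form nonnegative. -/

/-- The quadratic form `xᵀ M x`. -/
def qf {a : Type*} [Fintype a] (M : Matrix a a ℝ) (x : a → ℝ) : ℝ := x ⬝ᵥ M *ᵥ x

section QuadraticForm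

variable {a : Type*} [Fintype a]

@[simp] lemma qf_zero (M : Matrix a a ℝ) : qf M 0 = 0 := by simp [qf]

@[simp] lemma qf_zero_left (x : a → ℝ) : qf (0 : Matrix a a ℝ) x = 0 := by simp [qf]

lemma qf_add_left (M N : Matrix a a ℝ) (x : a → ℝ) : qf (M + N) x = qf M x + qf N x := by
  simp [qf, Matrix.add_mulVec, dotProduct_add]

lemma qf_sub_left (M N : Matrix a a ℝ) (x : a → ℝ) : qf (M - N) x = qf M x - qf N x := by
  simp [qf, Matrix.sub_mulVec, dotProduct_sub]

lemma qf_neg_left (M : Matrix a a ℝ) (x : a → ℝ) : qf (-M) x = -qf M x := by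
  simp [qf, Matrix.neg_mulVec]

lemma qf_smul_left (c : ℝ) (M : Matrix a a ℝ) (x : a → ℝ) : qf (c • M) x = c * qf M x := by
  simp [qf, Matrix.smul_mulVec]

lemma qf_smul (M : Matrix a a ℝ) (c : ℝ) (x : a → ℝ) : qf M (c • x) = c ^ 2 * qf M x := by
  simp [qf, Matrix.mulVec_smul]; ring

lemma continuous_qf (M : Matrix a a ℝ) : Continuous (qf M) := by
  unfold qf; fun_prop

lemma dotProduct_mulVec_transpose (M : Matrix a a ℝ) (x y : a → ℝ) :
    x ⬝ᵥ Mᵀ *ᵥ y = y ⬝ᵥ M *ᵥ x := by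
  rw [Matrix.mulVec_transpose, dotProduct_comm, Matrix.dotProduct_mulVec]

lemma qf_transpose (M : Matrix a a ℝ) (x : a → ℝ) : qf Mᵀ x = qf M x :=
  dotProduct_mulVec_transpose M x x

lemma qf_He (M : Matrix a a ℝ) (x : a → ℝ) : qf (He M) x = 2 * qf M x := by
  rw [He, qf_add_left, qf_transpose]; ring

lemma dotProduct_mulVec_comm_of_posSemidef {M : Matrix a a ℝ} (hM : M.PosSemidef) (x y : a → ℝ) :
    x ⬝ᵥ M *ᵥ y = y ⬝ᵥ M *ᵥ x := by
  have h : Mᵀ = M := by simpa using hM.isHermitian.eq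
  conv_lhs => rw [← h]
  exact dotProduct_mulVec_transpose M x y

lemma qf_add_of_posSemidef {M : Matrix a a ℝ} (hM : M.PosSemidef) (x y : a → ℝ) :
    qf M (x + y) = qf M x + qf M y + 2 * (x ⬝ᵥ M *ᵥ y) := by
  simp only [qf, Matrix.mulVec_add, dotProduct_add, add_dotProduct]
  rw [dotProduct_mulVec_comm_of_posSemidef hM y x]; ring

lemma qf_nonneg {M : Matrix a a ℝ} (hM : M.PosSemidef) (x : a → ℝ) : 0 ≤ qf M x := by
  simpa [qf] using hM.dotProduct_mulVec_nonneg x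

lemma qf_pos {M : Matrix a a ℝ} (hM : M.PosDef) {x : a → ℝ} (hx : x ≠ 0) : 0 < qf M x := by
  simpa [qf] using hM.dotProduct_mulVec_pos hx

/-- A positive semidefinite form is a sum of squares of linear forms. -/
lemma exists_qf_eq_sum_sq {M : Matrix a a ℝ} (hM : M.PosSemidef) :
    ∃ (m : ℕ) (v : Fin m → a → ℝ), ∀ x, qf M x = ∑ i, (v i ⬝ᵥ x) ^ 2 := by
  obtain ⟨m, v, rfl⟩ := Matrix.posSemidef_iff_eq_sum_vecMulVec.mp hM
  refine ⟨m, v, fun x => ?_⟩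
  simp only [qf, Matrix.sum_mulVec, dotProduct_sum, Matrix.vecMulVec_mulVec]
  refine Finset.sum_congr rfl fun i _ => ?_
  simp [dotProduct_comm x (v i), sq]

/-- A negative definite form is bounded by a negative multiple of the squared norm. -/
lemma exists_qf_le_of_negDef {M : Matrix a a ℝ} (hM : NegDef M) :
    ∃ c : ℝ, 0 < c ∧ ∀ x, qf M x ≤ -(c * ‖x‖ ^ 2) := by
  rcases isEmpty_or_nonempty a with ha | ha
  · exact ⟨1, one_pos, fun x => by simp [Subsingleton.elim x 0]⟩
  obtain ⟨u, hu, hmin⟩ := (isCompact_sphere (0 : a → ℝ) 1).exists_isMinOn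
    (NormedSpace.sphere_nonempty.2 zero_le_one) (continuous_qf (-M)).continuousOn
  have hu0 : u ≠ 0 := by
    rintro rfl; simp at hu
  refine ⟨qf (-M) u, qf_pos hM hu0, fun x => ?_⟩
  rcases eq_or_ne x 0 with rfl | hx
  · simp
  have hx' : 0 < ‖x‖ := norm_pos_iff.2 hx
  have h1 : ‖x‖⁻¹ • x ∈ Metric.sphere (0 : a → ℝ) 1 := by
    simp [norm_smul, hx'.ne']
  have h2 : qf (-M) u ≤ qf (-M) (‖x‖⁻¹ • x) := hmin h1
  rw [qf_smul, qf_neg_left _ x] at h2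
  have h3 := mul_le_mul_of_nonneg_left h2 (sq_nonneg ‖x‖)
  have h4 : ‖x‖ ^ 2 * (‖x‖⁻¹ ^ 2 * -qf M x) = -qf M x := by
    field_simp
  linarith

end QuadraticForm

/-! ### The discrete Wirtinger inequality -/

lemma sum_range_mul_sub (f : ℕ → ℝ) (n : ℕ) :
    ∑ l ∈ Finset.range n, (l : ℝ) * (f l - f (l + 1)) =
      ∑ l ∈ Finset.range (n + 1), f l - f 0 - n * f n := by
  induction n with
  | zero => simp
  | succ k ih =>
    rw [Finset.sum_range_succ, ih, Finset.sum_range_succ _ (k + 1)]; push_cast; ring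

lemma sum_range_sq_affine (α β : ℝ) (n : ℕ) (m : ℝ) :
    ∑ l ∈ Finset.range n, (α + β * (2 * (l : ℝ) - m)) ^ 2 =
      n * (α - β * m) ^ 2 + 2 * (α - β * m) * β * (n * (n - 1)) +
        4 * β ^ 2 * (n * (n - 1) * (2 * n - 1) / 6) := by
  induction n with
  | zero => simp
  | succ k ih => rw [Finset.sum_range_succ, ih]; push_cast; ring

/-- Approximate the increments by an affine function of the index. The squared error is nonnegative
for every choice of coefficients, and the inequality is its value at the least-squares fit. Centring
the index at (n-1)/2 makes the linear part orthogonal to constants, so the two coefficients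
decouple. For n ≤ 1 the term with v vanishes. -/
lemma wirtinger_real (f : ℕ → ℝ) (n : ℕ) (v : ℝ)
    (hv : ((n : ℝ) + 1) * v = ∑ l ∈ Finset.range (n + 1), f l) :
    (f 0 - f n) ^ 2 + 3 * gam n * (f 0 + f n - 2 * v) ^ 2 ≤
      n * ∑ l ∈ Finset.range n, (f l - f (l + 1)) ^ 2 := by
  rcases Nat.eq_zero_or_pos n with rfl | hn
  · have : v = f 0 := by simpa using hv
    simp [this, show f 0 + f 0 - 2 * f 0 = 0 by ring]
  rcases Nat.eq_or_lt_of_le hn with h1 | h1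
  · obtain rfl : n = 1 := by omega
    have : v = (f 0 + f 1) / 2 := by
      simp [Finset.sum_range_succ] at hv; linarith
    simp [this, gam, show f 0 + f 1 - 2 * ((f 0 + f 1) / 2) = 0 by ring]
  have hn' : (1 : ℝ) < n := by exact_mod_cast h1
  set E := ∑ l ∈ Finset.range n, (f l - f (l + 1)) ^ 2
  set s := f 0 - f n
  set w := f 0 + f n - 2 * v
  have key : ∀ α β : ℝ, 0 ≤ E - 2 * α * s + 2 * β * ((n + 1) * w) +
      n * α ^ 2 + β ^ 2 * (n * (n ^ 2 - 1) / 3) := by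
    intro α β
    have h0 : 0 ≤ ∑ l ∈ Finset.range n,
        ((f l - f (l + 1)) - (α + β * (2 * (l : ℝ) - (n - 1)))) ^ 2 :=
      Finset.sum_nonneg fun _ _ => sq_nonneg _
    have h1 : ∑ l ∈ Finset.range n,
        ((f l - f (l + 1)) - (α + β * (2 * (l : ℝ) - (n - 1)))) ^ 2 =
        E - 2 * (α - β * (n - 1)) * ∑ l ∈ Finset.range n, (f l - f (l + 1)) -
          4 * β * ∑ l ∈ Finset.range n, (l : ℝ) * (f l - f (l + 1)) +
          ∑ l ∈ Finset.range n, (α + β * (2 * (l : ℝ) - (n - 1))) ^ 2 := by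
      rw [Finset.mul_sum, Finset.mul_sum, ← Finset.sum_sub_distrib, ← Finset.sum_sub_distrib,
        ← Finset.sum_add_distrib]
      exact Finset.sum_congr rfl fun _ _ => by ring
    rw [h1, sum_range_mul_sub, sum_range_sq_affine, Finset.sum_range_sub', ← hv] at h0
    simp only [s, w]
    linarith
  -- These α and β minimise the quadratic expression in `key`.
  have h := key (s / n) (-(3 * w / (n * (n - 1))))
  have hn0 : (n : ℝ) ≠ 0 := by positivity
  have hn1 : (n : ℝ) - 1 ≠ 0 := by linarith
  have hg : gam n = ((n : ℝ) + 1) / (n - 1) := by rw [gam, if_neg (by omega)]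
  have h2 : (n : ℝ) * (E - 2 * (s / n) * s + 2 * (-(3 * w / (n * (n - 1)))) * ((n + 1) * w) +
      n * (s / n) ^ 2 + (-(3 * w / (n * (n - 1)))) ^ 2 * (n * (n ^ 2 - 1) / 3)) =
      n * E - s ^ 2 - 3 * gam n * w ^ 2 := by
    rw [hg]; field_simp; ring
  have h3 : 0 ≤ (n : ℝ) * _ := mul_nonneg (by positivity) h
  rw [h2] at h3
  linarith

lemma one_le_gam {n : ℕ} (hn : 1 ≤ n) : 1 ≤ gam n := by
  unfold gam
  split_ifs with h
  · exact le_rfl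
  · have : (1 : ℝ) < n := by exact_mod_cast (by omega : 1 < n)
    rw [le_div_iff₀ (by linarith)]; linarith

/-- The average over a single point is the value there. This settles the degenerate windows that
occur when the delay sits at an end of its range. -/
lemma add_sub_two_smul_eq_zero {κ : Type*} {h : ℕ → κ → ℝ} {a b : ℕ} (hab : a = b) {v : κ → ℝ}
    (hv : ((b : ℝ) - a + 1) • v = ∑ l ∈ Finset.Icc a b, h l) :
    h a + h b - (2 : ℝ) • v = 0 := by
  subst hab
  simp at hv
  rw [hv, two_smul]; simp

section Wirtinger

variable {ι : Type*} [Fintype ι]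

/-- `∑ (x_l - x_{l+1})ᵀ Z (x_l - x_{l+1})` over `a ≤ l < b`. -/
def energy (Z : Matrix ι ι ℝ) (a b : ℕ) (h : ℕ → ι → ℝ) : ℝ :=
  ∑ l ∈ Finset.Ico a b, qf Z (h l - h (l + 1))

lemma energy_nonneg {Z : Matrix ι ι ℝ} (hZ : Z.PosSemidef) (a b : ℕ) (h : ℕ → ι → ℝ) :
    0 ≤ energy Z a b h :=
  Finset.sum_nonneg fun _ _ => qf_nonneg hZ _

lemma energy_add (Z : Matrix ι ι ℝ) {a b c : ℕ} (hab : a ≤ b) (hbc : b ≤ c) (h : ℕ → ι → ℝ) :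
    energy Z a b h + energy Z b c h = energy Z a c h :=
  Finset.sum_Ico_consecutive _ hab hbc

/-- Writing Z as a sum of squares of linear forms reduces the claim to the scalar inequality for
each form. -/
lemma wirtinger {Z : Matrix ι ι ℝ} (hZ : Z.PosSemidef) (h : ℕ → ι → ℝ) {a b : ℕ} (hab : a ≤ b)
    {v : ι → ℝ} (hv : ((b : ℝ) - a + 1) • v = ∑ l ∈ Finset.Icc a b, h l) :
    qf Z (h a - h b) + 3 * gam (b - a) * qf Z (h a + h b - (2 : ℝ) • v) ≤
      ((b : ℝ) - a) * energy Z a b h := by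
  obtain ⟨m, u, hu⟩ := exists_qf_eq_sum_sq hZ
  obtain ⟨n, rfl⟩ := Nat.exists_eq_add_of_le hab
  have hicc : Finset.Icc a (a + n) = Finset.Ico a (a + n + 1) := by ext; simp
  rw [hicc, Finset.sum_Ico_eq_sum_range] at hv
  simp only [energy, hu, Finset.sum_Ico_eq_sum_range]
  rw [Finset.sum_comm, Finset.mul_sum, Finset.mul_sum, ← Finset.sum_add_distrib]
  refine Finset.sum_le_sum fun i _ => ?_
  have hvi := congrArg (fun y => u i ⬝ᵥ y) hv
  simp only [dotProduct_smul, dotProduct_sum, smul_eq_mul] at hvi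
  have e1 : a + n + 1 - a = n + 1 := by omega
  have e2 : a + n - a = n := by omega
  rw [e1] at hvi
  rw [e2]
  have := wirtinger_real (fun l => u i ⬝ᵥ h (a + l)) n (u i ⬝ᵥ v) (by
    rw [← hvi]; push_cast; ring)
  simp only [add_zero] at this
  simp only [dotProduct_sub, dotProduct_add, dotProduct_smul, smul_eq_mul]
  push_cast
  have e3 : (a : ℝ) + n - a = n := by ring
  rw [e3]
  simpa only [add_assoc] using this

/-- The Wirtinger inequality with the constant `γ` replaced by `1`. -/
lemma wirtinger_three {Z : Matrix ι ι ℝ} (hZ : Z.PosSemidef) (h : ℕ → ι → ℝ) {a b : ℕ}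
    (hab : a ≤ b) {v : ι → ℝ} (hv : ((b : ℝ) - a + 1) • v = ∑ l ∈ Finset.Icc a b, h l) :
    qf Z (h a - h b) + 3 * qf Z (h a + h b - (2 : ℝ) • v) ≤ ((b : ℝ) - a) * energy Z a b h := by
  have hw := wirtinger hZ h hab hv
  -- The empty range needs its own case: `gam 0` equals -1, so γ cannot be bounded below by 1 there,
  -- but its factor is zero.
  rcases Nat.eq_or_lt_of_le hab with he | hl
  · have := add_sub_two_smul_eq_zero he hv
    rw [this] at hw ⊢
    simpa using hw
  · have h1 := one_le_gam (n := b - a) (by omega)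
    have h2 := qf_nonneg hZ (h a + h b - (2 : ℝ) • v)
    nlinarith

end Wirtinger

/-- The reciprocally convex combination inequality, in scalar form. -/
lemma reciprocally_convex {n₁ n₂ E F g k c : ℝ} (hn₁ : 0 ≤ n₁) (hn₂ : 0 ≤ n₂) (hE : 0 ≤ E)
    (hF : 0 ≤ F) (hg : g ≤ n₂ * E) (hk : k ≤ n₁ * F)
    (hpsd : ∀ s t : ℝ, 0 ≤ s ^ 2 * g + t ^ 2 * k + 2 * (s * t * c))
    (h₁ : n₁ = 0 → c = 0) (h₂ : n₂ = 0 → c = 0) :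
    g + k + 2 * c ≤ (n₁ + n₂) * (E + F) := by
  rcases hn₁.eq_or_lt with h | h
  · have := h₁ h.symm
    subst h; subst this
    nlinarith
  rcases hn₂.eq_or_lt with h' | h'
  · have := h₂ h'.symm
    subst h'; subst this
    nlinarith
  -- This test pair bounds 2n₁n₂c by n₁²g + n₂²k, so n₁n₂(g + k + 2c) is at most (n₁ + n₂)(n₁g +
  -- n₂k). Dividing by n₁n₂ requires both lengths to be nonzero, hence the two earlier cases.
  have h3 := hpsd n₁ (-n₂)
  have h4 : n₁ * g ≤ n₁ * (n₂ * E) := mul_le_mul_of_nonneg_left hg hn₁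
  have h5 : n₂ * k ≤ n₂ * (n₁ * F) := mul_le_mul_of_nonneg_left hk hn₂
  have h6 : (n₁ + n₂) * (n₁ * g + n₂ * k) ≤ (n₁ + n₂) * (n₁ * (n₂ * E) + n₂ * (n₁ * F)) :=
    mul_le_mul_of_nonneg_left (by linarith) (by linarith)
  have h7 : (n₁ * n₂) * (g + k + 2 * c) ≤ (n₁ * n₂) * ((n₁ + n₂) * (E + F)) := by
    nlinarith
  exact le_of_mul_le_mul_left h7 (mul_pos h h')

/-! ### Block vectors -/

/-- Flatten a vector of vectors. -/
def vec {a ι : Type*} (X : a → ι → ℝ) : a × ι → ℝ := fun p => X p.1 p.2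

/-- The linear combinations of the blocks of `X` with the coefficients in the rows of `w`. -/
def comb {a b ι : Type*} [Fintype b] (w : Matrix a b ℝ) (X : b → ι → ℝ) : a → ι → ℝ :=
  fun i => ∑ k, w i k • X k

section BlockVectors

variable {a b ι : Type*} [Fintype a] [Fintype b] [Fintype ι]

@[simp] lemma vec_zero {a ι : Type*} : vec (0 : a → ι → ℝ) = 0 := rfl

lemma vec_add {a ι : Type*} (X Y : a → ι → ℝ) : vec (X + Y) = vec X + vec Y := rfl

lemma vec_dotProduct_vec (X Y : a → ι → ℝ) : vec X ⬝ᵥ vec Y = ∑ i, X i ⬝ᵥ Y i := by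
  simp [dotProduct, vec, Fintype.sum_prod_type]

lemma flat_mulVec_vec {κ : Type*} [Fintype κ] (M : Matrix a b (Matrix ι κ ℝ)) (X : b → κ → ℝ) :
    flat M *ᵥ vec X = vec fun i => ∑ k, M i k *ᵥ X k := by
  ext p
  simp [Matrix.mulVec, dotProduct, flat, vec, Fintype.sum_prod_type]

lemma scal_mulVec_vec [DecidableEq ι] (w : Matrix a b ℝ) (X : b → ι → ℝ) :
    scal ι w *ᵥ vec X = vec (comb w X) := by
  ext p
  simp [Matrix.mulVec, dotProduct, scal, vec, comb, Fintype.sum_prod_type, Matrix.one_apply]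

lemma qf_flat (M : Matrix a a (Matrix ι ι ℝ)) (X : a → ι → ℝ) :
    qf (flat M) (vec X) = ∑ i, ∑ k, X i ⬝ᵥ M i k *ᵥ X k := by
  simp [qf, flat_mulVec_vec, vec_dotProduct_vec, dotProduct_sum]

lemma qf_flat_diagonal [DecidableEq a] (M : a → Matrix ι ι ℝ) (X : a → ι → ℝ) :
    qf (flat (Matrix.diagonal M)) (vec X) = ∑ i, qf (M i) (X i) := by
  rw [qf_flat]
  refine Finset.sum_congr rfl fun i _ => ?_
  rw [Finset.sum_eq_single i]
  · simp [qf]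
  · intro k _ hk
    simp [Matrix.diagonal_apply_ne _ hk.symm]
  · simp

lemma qf_conj (P : Matrix a a ℝ) (W : Matrix a b ℝ) (x : b → ℝ) :
    qf (Wᵀ * P * W) x = qf P (W *ᵥ x) := by
  simp only [qf, ← Matrix.mulVec_mulVec, Matrix.mulVec_transpose]
  rw [dotProduct_comm, ← Matrix.dotProduct_mulVec]
  exact dotProduct_comm _ _

lemma comb_add (v w : Matrix a b ℝ) (X : b → ι → ℝ) : comb (v + w) X = comb v X + comb w X := by
  ext i r
  simp [comb, add_mul, Finset.sum_add_distrib]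

lemma qf_diagZ (c : ℝ) (Z : Matrix ι ι ℝ) (X : Fin 2 → ι → ℝ) :
    qf (diagZ c Z) (vec X) = qf Z (X 0) + c * qf Z (X 1) := by
  simp [diagZ, qf_flat_diagonal, qf_smul_left]

lemma qf_psiZ (Z : Matrix ι ι ℝ) (Y : Matrix (Fin 2 × ι) (Fin 2 × ι) ℝ) (u v : Fin 2 × ι → ℝ) :
    qf (psiZ Z Y) (Sum.elim u v) = qf (diagZ 3 Z) u + qf (diagZ 3 Z) v + 2 * (u ⬝ᵥ Y *ᵥ v) := by
  simp only [qf, psiZ, Matrix.fromBlocks_mulVec, sumElim_dotProduct_sumElim, dotProduct_add,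
    Sum.elim_comp_inl, Sum.elim_comp_inr, dotProduct_mulVec_transpose]
  ring

lemma wPsi_mulVec_vec [DecidableEq ι] (t l : Matrix (Fin 2) b ℝ) (X : b → ι → ℝ) :
    wPsi ι t l *ᵥ vec X = Sum.elim (vec (comb t X)) (vec (comb l X)) := by
  simp [wPsi, Matrix.fromRows_mulVec, scal_mulVec_vec]

variable [DecidableEq ι]

/-- Expanding both squares, the terms quadratic in v cancel and the cross terms are the He part.
Thus a difference of two squares, each depending on the delay through v, is affine in the delay. -/
lemma qf_phiOne {P : Matrix (a × ι) (a × ι) ℝ} (hP : P.PosSemidef) (v1 v2 v : Matrix a b ℝ)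
    (X : b → ι → ℝ) :
    qf (phiOne P v1 v2 v) (vec X) =
      qf P (vec (comb (v2 + v) X)) - qf P (vec (comb (v1 + v) X)) := by
  have h : qf ((scal ι v)ᵀ * P * (scal ι v2 - scal ι v1)) (vec X) =
      vec (comb v X) ⬝ᵥ P *ᵥ vec (comb v2 X) - vec (comb v X) ⬝ᵥ P *ᵥ vec (comb v1 X) := by
    simp only [qf, ← Matrix.mulVec_mulVec, Matrix.sub_mulVec, scal_mulVec_vec, Matrix.mulVec_sub,
      dotProduct_sub, Matrix.mulVec_transpose]
    rw [dotProduct_comm, ← Matrix.dotProduct_mulVec, scal_mulVec_vec, dotProduct_comm (vec X),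
      ← Matrix.dotProduct_mulVec, scal_mulVec_vec]
    simp only [dotProduct_comm]
  rw [phiOne, qf_add_left, qf_sub_left, qf_conj, qf_conj, qf_He, h, scal_mulVec_vec,
    scal_mulVec_vec, comb_add, comb_add, vec_add, vec_add, qf_add_of_posSemidef hP,
    qf_add_of_posSemidef hP, dotProduct_mulVec_comm_of_posSemidef hP (vec (comb v X)),
    dotProduct_mulVec_comm_of_posSemidef hP (vec (comb v X))]
  ring

/-- The form of `Ῡ` vanishes along the implicit closed-loop equation. -/
lemma qf_upsilon (k : ℕ) (ε : ℝ) (J A Am Ad AM : Matrix ι ι ℝ) (X : Fin (5 + k) → ι → ℝ) :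
    qf (upsilon (5 + k) ε J A Am Ad AM) (vec X) =
      2 * ((X (Fin.castAdd k 0) + ε • X (Fin.castAdd k 1)) ⬝ᵥ
        (-(Jᵀ *ᵥ X (Fin.castAdd k 0)) + A *ᵥ X (Fin.castAdd k 1) + Am *ᵥ X (Fin.castAdd k 2) +
          Ad *ᵥ X (Fin.castAdd k 3) + AM *ᵥ X (Fin.castAdd k 4))) := by
  rw [upsilon, qf_flat, Fin.sum_univ_add]
  have h1 : ∀ i : Fin k, ∀ N : Matrix (Fin 5) (Fin 5) (Matrix ι ι ℝ), ∀ q : Fin (5 + k),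
      padZero (5 + k) N (Fin.natAdd 5 i) q = 0 := by
    intro i N q; simp [padZero]
  have h2 : ∀ i : Fin k, ∀ N : Matrix (Fin 5) (Fin 5) (Matrix ι ι ℝ), ∀ q : Fin (5 + k),
      padZero (5 + k) N q (Fin.natAdd 5 i) = 0 := by
    intro i N q; simp [padZero]
  have h3 : ∀ i j : Fin 5, ∀ N : Matrix (Fin 5) (Fin 5) (Matrix ι ι ℝ),
      padZero (5 + k) N (Fin.castAdd k i) (Fin.castAdd k j) = N i j := by
    intro i j N; simp [padZero]
  simp only [Fin.sum_univ_add, h1, h2, h3, Matrix.zero_mulVec, dotProduct_zero,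
    Finset.sum_const_zero, add_zero]
  simp only [Fin.sum_univ_five]
  simp [Matrix.add_mulVec, Matrix.sub_mulVec, Matrix.neg_mulVec, Matrix.smul_mulVec,
    dotProduct_mulVec_transpose, dotProduct_add, add_dotProduct]
  ring

end BlockVectors

/-! ### The forms Φ(d, j) and their affine dependence on d -/

section Phi

variable {ι : Type*} [Fintype ι] [DecidableEq ι]

lemma comb_ext {a : Type*} [Fintype a] (w : Matrix a (Fin 8) ℝ) (X : Fin 10 → ι → ℝ) :
    comb (ext w) X = comb w fun k => X (Fin.castAdd 2 k) := by
  ext i : 1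
  simp only [comb, Fin.sum_univ_add (a := 8) (b := 2) (fun k => ext w i k • X k)]
  simp [ext]

lemma comb_w3 (X : Fin 8 → ι → ℝ) : comb w3 X 0 = X 0 - X 1 := by
  simp [comb, w3, Fin.sum_univ_eight, sub_eq_add_neg]

lemma comb_ws (X : Fin 8 → ι → ℝ) : comb ws X = ![X 1 - X 2, X 1 + X 2 - (2 : ℝ) • X 5] := by
  ext i r
  fin_cases i <;> simp [comb, ws, Fin.sum_univ_eight, sub_eq_add_neg]

lemma comb_wPsiTop (X : Fin 8 → ι → ℝ) :
    comb wPsiTop X = ![X 3 - X 4, X 3 + X 4 - (2 : ℝ) • X 7] := by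
  ext i r
  fin_cases i <;> simp [comb, wPsiTop, Fin.sum_univ_eight, sub_eq_add_neg]

lemma comb_wPsiBot (X : Fin 8 → ι → ℝ) :
    comb wPsiBot X = ![X 2 - X 3, X 2 + X 3 - (2 : ℝ) • X 6] := by
  ext i r
  fin_cases i <;> simp [comb, wPsiBot, Fin.sum_univ_eight, sub_eq_add_neg]

lemma comb_wz (X : Fin 10 → ι → ℝ) :
    comb wz X = ![X 4 - X 8, X 4 + X 8 - (2 : ℝ) • X 9] := by
  ext i r
  fin_cases i <;> simp [comb, wz, Fin.sum_univ_castSucc, sub_eq_add_neg]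

lemma qf_phiMode2 (dn dM : ℕ) {P : Matrix (Fin 3 × ι) (Fin 3 × ι) ℝ} (hP : P.PosSemidef)
    (Q1 Q2 Z1 Z2 : Matrix ι ι ℝ) (Y : Matrix (Fin 2 × ι) (Fin 2 × ι) ℝ) (d : ℕ)
    (X : Fin 8 → ι → ℝ) :
    qf (phiMode2 dn dM P Q1 Q2 Z1 Z2 Y d) (vec X) =
      qf P (vec (comb (w2 dn dM + wd d) X)) - qf P (vec (comb (w1 dn dM + wd d) X)) +
        (qf Q1 (X 1) + (qf Q2 (X 2) - qf Q1 (X 2)) - qf Q2 (X 4)) +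
        ((dn : ℝ) ^ 2 * qf Z1 (X 0 - X 1) + ((dM : ℝ) - dn) ^ 2 * qf Z2 (X 0 - X 1)) -
        (qf Z1 (X 1 - X 2) + 3 * gam dn * qf Z1 (X 1 + X 2 - (2 : ℝ) • X 5)) -
        qf (psiZ Z2 Y) (Sum.elim (vec ![X 3 - X 4, X 3 + X 4 - (2 : ℝ) • X 7])
          (vec ![X 2 - X 3, X 2 + X 3 - (2 : ℝ) • X 6])) := by
  simp only [phiMode2, qf_add_left, qf_sub_left, qf_phiOne hP, qf_conj, scal_mulVec_vec,
    wPsi_mulVec_vec, qf_flat_diagonal, qf_diagZ, comb_ws, comb_wPsiTop, comb_wPsiBot]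
  simp [Fin.sum_univ_eight, comb_w3, qf_add_left, qf_sub_left, qf_smul_left, qf_neg_left]
  ring

lemma qf_phiMode1 (dm dn dM : ℕ) {P : Matrix (Fin 4 × ι) (Fin 4 × ι) ℝ} (hP : P.PosSemidef)
    (Q1 Q2 Q3 Z1 Z2 Z3 : Matrix ι ι ℝ) (Y : Matrix (Fin 2 × ι) (Fin 2 × ι) ℝ) (d : ℕ)
    (X : Fin 10 → ι → ℝ) :
    qf (phiMode1 dm dn dM P Q1 Q2 Q3 Z1 Z2 Z3 Y d) (vec X) =
      qf P (vec (comb (w2One dm dn ((dM : ℝ) - dn) + wdOne d) X)) -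
        qf P (vec (comb (w1One dm dn ((dM : ℝ) - dn) + wdOne d) X)) +
        (qf Q1 (X 1) + (qf Q2 (X 2) - qf Q1 (X 2)) + (qf Q3 (X 4) - qf Q2 (X 4))) +
        ((dm : ℝ) ^ 2 * qf Z1 (X 0 - X 1) + ((dn : ℝ) - dm) ^ 2 * qf Z2 (X 0 - X 1) +
          ((dM : ℝ) - dn) ^ 2 * qf Z3 (X 0 - X 1)) -
        (qf Z1 (X 1 - X 2) + 3 * gam dm * qf Z1 (X 1 + X 2 - (2 : ℝ) • X 5)) -
        qf (psiZ Z2 Y) (Sum.elim (vec ![X 3 - X 4, X 3 + X 4 - (2 : ℝ) • X 7])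
          (vec ![X 2 - X 3, X 2 + X 3 - (2 : ℝ) • X 6])) -
        (qf Z3 (X 4 - X 8) + 3 * qf Z3 (X 4 + X 8 - (2 : ℝ) • X 9)) := by
  simp only [phiMode1, qf_add_left, qf_sub_left, qf_phiOne hP, qf_conj, scal_mulVec_vec,
    wPsi_mulVec_vec, qf_flat_diagonal, qf_diagZ, comb_ext, comb_ws, comb_wPsiTop, comb_wPsiBot,
    comb_wz]
  simp [Fin.sum_univ_castSucc, comb_w3, qf_add_left, qf_sub_left, qf_smul_left]
  ring

/-- An affine function that is at most `-r` at both ends of an interval is so in between. -/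
lemma affine_le {c₀ c₁ r a b d : ℝ} (had : a ≤ d) (hdb : d ≤ b) (ha : c₀ + a * c₁ ≤ r)
    (hb : c₀ + b * c₁ ≤ r) : c₀ + d * c₁ ≤ r := by
  rcases le_total 0 c₁ with h | h <;> nlinarith

/-- Only the He part contains v, and linearly. This is what reduces all delays in a range to its two
ends. -/
lemma qf_phiOne_smul {a b : Type*} [Fintype a] [Fintype b] (P : Matrix (a × ι) (a × ι) ℝ)
    (v1 v2 v : Matrix a b ℝ) (d : ℝ) (x : b × ι → ℝ) :
    qf (phiOne P v1 v2 (d • v)) x = qf (phiOne P v1 v2 0) x +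
      d * qf (He ((scal ι v)ᵀ * P * (scal ι v2 - scal ι v1))) x := by
  simp only [phiOne, qf_add_left, qf_He]
  have h0 : scal ι (0 : Matrix a b ℝ) = 0 := by simp [scal]
  have h1 : scal ι (d • v) = d • scal ι v := by simp [scal, Matrix.smul_kronecker]
  rw [h0, h1, Matrix.transpose_smul, Matrix.smul_mul, Matrix.smul_mul, qf_smul_left]
  simp
  ring

lemma wd_eq_smul (d : ℝ) : wd d = d • wd 1 := by
  ext i k; fin_cases i <;> fin_cases k <;> simp [wd]

lemma wdOne_eq_smul (d : ℝ) : wdOne d = d • wdOne 1 := by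
  ext i k; fin_cases i <;> fin_cases k <;> simp [wdOne]

lemma exists_qf_phiMode1_eq (dm dn dM : ℕ) (P : Matrix (Fin 4 × ι) (Fin 4 × ι) ℝ)
    (Q1 Q2 Q3 Z1 Z2 Z3 : Matrix ι ι ℝ) (Y : Matrix (Fin 2 × ι) (Fin 2 × ι) ℝ)
    (x : Fin 10 × ι → ℝ) :
    ∃ c₀ c₁ : ℝ, ∀ d : ℕ,
      qf (phiMode1 dm dn dM P Q1 Q2 Q3 Z1 Z2 Z3 Y d) x = c₀ + (d : ℝ) * c₁ := by
  -- The two coefficients stay open and are read off by unification once the term linear in d has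
  -- been moved last.
  refine ⟨?_, ?_, fun d => ?_⟩
  rotate_left 2
  · rw [phiMode1, qf_add_left, qf_add_left, wdOne_eq_smul, qf_phiOne_smul, add_assoc,
      add_right_comm]

lemma exists_qf_phiMode2_eq (dn dM : ℕ) (P : Matrix (Fin 3 × ι) (Fin 3 × ι) ℝ)
    (Q1 Q2 Z1 Z2 : Matrix ι ι ℝ) (Y : Matrix (Fin 2 × ι) (Fin 2 × ι) ℝ) (x : Fin 8 × ι → ℝ) :
    ∃ c₀ c₁ : ℝ, ∀ d : ℕ, qf (phiMode2 dn dM P Q1 Q2 Z1 Z2 Y d) x = c₀ + (d : ℝ) * c₁ := by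
  refine ⟨?_, ?_, fun d => ?_⟩
  rotate_left 2
  · rw [phiMode2, qf_add_left, qf_add_left, wd_eq_smul, qf_phiOne_smul, add_assoc,
      add_right_comm]

end Phi

/-! ### Sums over histories

A history is a sequence `h` with `h l = x(k - l)`; if `g` is the history at time `k + 1`, then the
history at time `k` is `fun l => g (l + 1)`. -/

section Sums

variable {M : Type*} [AddCommGroup M]

lemma sum_Icc_eq_add_sum_Ioc (h : ℕ → M) {a b : ℕ} (hab : a ≤ b) :
    ∑ l ∈ Finset.Icc a b, h l = h a + ∑ l ∈ Finset.Ioc a b, h l := by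
  rw [← Finset.Ioc_insert_left hab, Finset.sum_insert (by simp)]

/-- The closed window at time k contains the half-open window of time k + 1 and one older sample.
Hence the same averages express the sums in the functional at both times. -/
lemma sum_Icc_shift_eq (g : ℕ → M) {a b : ℕ} (hab : a ≤ b) :
    ∑ l ∈ Finset.Icc a b, g (l + 1) = g (b + 1) + ∑ l ∈ Finset.Ioc a b, g l := by
  induction b, hab using Nat.le_induction with
  | base => simp
  | succ n hn ih =>
    rw [Finset.sum_Icc_succ_top (by omega), ih, Finset.sum_Ioc_succ_top hn]; abel

lemma sum_Ioc_shift (g : ℕ → M) {a b : ℕ} (hab : a ≤ b) :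
    ∑ l ∈ Finset.Ioc a b, g (l + 1) = ∑ l ∈ Finset.Ioc a b, g l + g (b + 1) - g (a + 1) := by
  have h1 := sum_Icc_shift_eq g hab
  have h2 := sum_Icc_eq_add_sum_Ioc (fun l => g (l + 1)) hab
  rw [h1] at h2
  rw [eq_sub_iff_add_eq, add_comm, ← h2]; abel

lemma sum_Icc_add_sum_Icc (h : ℕ → M) {a b d : ℕ} (had : a ≤ d) (hdb : d ≤ b) :
    ∑ l ∈ Finset.Icc a d, h l + ∑ l ∈ Finset.Icc d b, h l =
      h d + ∑ l ∈ Finset.Icc a b, h l := by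
  rw [sum_Icc_eq_add_sum_Ioc h had, sum_Icc_eq_add_sum_Ioc h hdb,
    sum_Icc_eq_add_sum_Ioc h (had.trans hdb), ← Finset.sum_Ioc_consecutive h had hdb]
  abel

end Sums

/-! ### The Lyapunov functionals and their increments -/

section Functionals

variable {ι : Type*} [Fintype ι]

/-- The average of `h l` over `a ≤ l ≤ b`. -/
def avg (a b : ℕ) (h : ℕ → ι → ℝ) : ι → ℝ := ((b : ℝ) - a + 1)⁻¹ • ∑ l ∈ Finset.Icc a b, h l

lemma smul_avg {a b : ℕ} (hab : a ≤ b) (h : ℕ → ι → ℝ) :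
    ((b : ℝ) - a + 1) • avg a b h = ∑ l ∈ Finset.Icc a b, h l := by
  have : (a : ℝ) ≤ b := by exact_mod_cast hab
  rw [avg, smul_inv_smul₀]
  linarith

/-- The weight of the increment `x_l - x_{l+1}` in the double sum over the delay range `[a, b]`. -/
def weight (a b l : ℕ) : ℝ := ((b : ℝ) - a) * ((min (b - a) (b - l) : ℕ) : ℝ)

lemma weight_nonneg {a b : ℕ} (hab : a ≤ b) (l : ℕ) : 0 ≤ weight a b l := by
  have : (a : ℝ) ≤ b := by exact_mod_cast hab
  exact mul_nonneg (by linarith) (by positivity)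

lemma weight_of_le {a b l : ℕ} (hab : a ≤ b) (hl : l ≤ a) : weight a b l = ((b : ℝ) - a) ^ 2 := by
  rw [weight, min_eq_left (by omega), Nat.cast_sub hab, sq]

lemma weight_of_ge {a b l : ℕ} (hl : a ≤ l) (hlb : l ≤ b) :
    weight a b l = ((b : ℝ) - a) * ((b : ℝ) - l) := by
  rw [weight, min_eq_right (by omega), Nat.cast_sub hlb]

lemma weight_eq_zero {a b l : ℕ} (hl : b ≤ l) : weight a b l = 0 := by
  rw [weight, Nat.sub_eq_zero_of_le hl]; simp

/-- `∑ x_lᵀ Q x_l` over `a < l ≤ b`. -/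
def stateSum (Q : Matrix ι ι ℝ) (a b : ℕ) (h : ℕ → ι → ℝ) : ℝ := ∑ l ∈ Finset.Ioc a b, qf Q (h l)

/-- The double sum of increments over the delay range `[a, b]`. -/
def incSum (Z : Matrix ι ι ℝ) (a b : ℕ) (h : ℕ → ι → ℝ) : ℝ :=
  ∑ l ∈ Finset.range b, weight a b l * qf Z (h l - h (l + 1))

lemma stateSum_nonneg {Q : Matrix ι ι ℝ} (hQ : Q.PosSemidef) (a b : ℕ) (h : ℕ → ι → ℝ) :
    0 ≤ stateSum Q a b h :=
  Finset.sum_nonneg fun _ _ => qf_nonneg hQ _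

lemma incSum_nonneg {Z : Matrix ι ι ℝ} (hZ : Z.PosSemidef) {a b : ℕ} (hab : a ≤ b)
    (h : ℕ → ι → ℝ) : 0 ≤ incSum Z a b h :=
  Finset.sum_nonneg fun _ _ => mul_nonneg (weight_nonneg hab _) (qf_nonneg hZ _)

lemma stateSum_sub_shift (Q : Matrix ι ι ℝ) {a b : ℕ} (hab : a ≤ b) (g : ℕ → ι → ℝ) :
    stateSum Q a b g - stateSum Q a b (fun l => g (l + 1)) =
      qf Q (g (a + 1)) - qf Q (g (b + 1)) := by
  rw [stateSum, stateSum, sum_Ioc_shift (fun l => qf Q (g l)) hab]; ring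

/-- Summation by parts: ageing by one step moves an increment from weight w(l) to w(l+1). The loss
w(l) - w(l+1) is zero for l < a and b - a for a ≤ l < b, while the newest increment enters with the
full weight (b - a)². -/
lemma incSum_sub_shift (Z : Matrix ι ι ℝ) {a b : ℕ} (hab : a ≤ b) (g : ℕ → ι → ℝ) :
    incSum Z a b g - incSum Z a b (fun l => g (l + 1)) =
      ((b : ℝ) - a) ^ 2 * qf Z (g 0 - g 1) -
        ((b : ℝ) - a) * energy Z a b (fun l => g (l + 1)) := by
  have h1 : incSum Z a b g =
      ∑ l ∈ Finset.range b, weight a b (l + 1) * qf Z (g (l + 1) - g (l + 1 + 1)) +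
        ((b : ℝ) - a) ^ 2 * qf Z (g 0 - g 1) := by
    rw [← weight_of_le hab (Nat.zero_le a), ← Finset.sum_range_succ'
      (fun l => weight a b l * qf Z (g l - g (l + 1))), Finset.sum_range_succ,
      weight_eq_zero le_rfl, zero_mul, add_zero, incSum]
  have h2 : ((b : ℝ) - a) * energy Z a b (fun l => g (l + 1)) =
      ∑ l ∈ Finset.range b, (weight a b l - weight a b (l + 1)) *
        qf Z (g (l + 1) - g (l + 1 + 1)) := by
    have h3 : ∀ l ∈ Finset.range b, (weight a b l - weight a b (l + 1)) *
        qf Z (g (l + 1) - g (l + 1 + 1)) =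
        if a ≤ l then ((b : ℝ) - a) * qf Z (g (l + 1) - g (l + 1 + 1)) else 0 := by
      intro l hl
      have hl : l < b := Finset.mem_range.1 hl
      split_ifs with ha
      · rw [weight_of_ge ha hl.le, weight_of_ge (by omega) (by omega)]; push_cast; ring
      · rw [weight_of_le hab (by omega), weight_of_le hab (by omega)]; ring
    rw [Finset.sum_congr rfl h3, ← Finset.sum_filter, energy, Finset.mul_sum]
    refine Finset.sum_congr ?_ fun _ _ => rfl
    ext l; simp; omega
  rw [h1, h2, incSum]
  simp only [sub_mul, Finset.sum_sub_distrib]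
  ring

/-- The Lyapunov functional of the first mode. -/
def lyapOne (dm dn dM : ℕ) (P : Matrix (Fin 4 × ι) (Fin 4 × ι) ℝ)
    (Q1 Q2 Q3 Z1 Z2 Z3 : Matrix ι ι ℝ) (h : ℕ → ι → ℝ) : ℝ :=
  qf P (vec ![h 0, ∑ l ∈ Finset.Ioc 0 dm, h l, ∑ l ∈ Finset.Ioc dm dn, h l,
      ∑ l ∈ Finset.Ioc dn dM, h l]) +
    (stateSum Q1 0 dm h + stateSum Q2 dm dn h + stateSum Q3 dn dM h) +
    (incSum Z1 0 dm h + incSum Z2 dm dn h + incSum Z3 dn dM h)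

/-- The Lyapunov functional of the second mode. -/
def lyapTwo (dn dM : ℕ) (P : Matrix (Fin 3 × ι) (Fin 3 × ι) ℝ) (Q1 Q2 Z1 Z2 : Matrix ι ι ℝ)
    (h : ℕ → ι → ℝ) : ℝ :=
  qf P (vec ![h 0, ∑ l ∈ Finset.Ioc 0 dn, h l, ∑ l ∈ Finset.Ioc dn dM, h l]) +
    (stateSum Q1 0 dn h + stateSum Q2 dn dM h) + (incSum Z1 0 dn h + incSum Z2 dn dM h)

lemma lyapOne_nonneg {dm dn dM : ℕ} (hmn : dm ≤ dn) (hnM : dn ≤ dM)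
    {P : Matrix (Fin 4 × ι) (Fin 4 × ι) ℝ} {Q1 Q2 Q3 Z1 Z2 Z3 : Matrix ι ι ℝ} (hP : P.PosSemidef)
    (hQ1 : Q1.PosSemidef) (hQ2 : Q2.PosSemidef) (hQ3 : Q3.PosSemidef) (hZ1 : Z1.PosSemidef)
    (hZ2 : Z2.PosSemidef) (hZ3 : Z3.PosSemidef) (h : ℕ → ι → ℝ) :
    0 ≤ lyapOne dm dn dM P Q1 Q2 Q3 Z1 Z2 Z3 h :=
  add_nonneg (add_nonneg (qf_nonneg hP _)
    (add_nonneg (add_nonneg (stateSum_nonneg hQ1 _ _ _) (stateSum_nonneg hQ2 _ _ _))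
      (stateSum_nonneg hQ3 _ _ _)))
    (add_nonneg (add_nonneg (incSum_nonneg hZ1 (Nat.zero_le _) _) (incSum_nonneg hZ2 hmn _))
      (incSum_nonneg hZ3 hnM _))

lemma lyapTwo_nonneg {dn dM : ℕ} (hnM : dn ≤ dM) {P : Matrix (Fin 3 × ι) (Fin 3 × ι) ℝ}
    {Q1 Q2 Z1 Z2 : Matrix ι ι ℝ} (hP : P.PosSemidef) (hQ1 : Q1.PosSemidef) (hQ2 : Q2.PosSemidef)
    (hZ1 : Z1.PosSemidef) (hZ2 : Z2.PosSemidef) (h : ℕ → ι → ℝ) :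
    0 ≤ lyapTwo dn dM P Q1 Q2 Z1 Z2 h :=
  add_nonneg (add_nonneg (qf_nonneg hP _)
    (add_nonneg (stateSum_nonneg hQ1 _ _ _) (stateSum_nonneg hQ2 _ _ _)))
    (add_nonneg (incSum_nonneg hZ1 (Nat.zero_le _) _) (incSum_nonneg hZ2 hnM _))

/-- The increments in the delay range `[a, b]`, split at the current delay `d`, dominate the
form of `Ψ`. -/
lemma qf_psiZ_le {Z : Matrix ι ι ℝ} (hZ : Z.PosSemidef) {Y : Matrix (Fin 2 × ι) (Fin 2 × ι) ℝ}
    (hΨ : (psiZ Z Y).PosSemidef) (h : ℕ → ι → ℝ) {a b d : ℕ} (had : a ≤ d) (hdb : d ≤ b) :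
    qf (psiZ Z Y) (Sum.elim (vec ![h d - h b, h d + h b - (2 : ℝ) • avg d b h])
      (vec ![h a - h d, h a + h d - (2 : ℝ) • avg a d h])) ≤
      ((b : ℝ) - a) * energy Z a b h := by
  have had' : (a : ℝ) ≤ d := by exact_mod_cast had
  have hdb' : (d : ℝ) ≤ b := by exact_mod_cast hdb
  set u := vec ![h d - h b, h d + h b - (2 : ℝ) • avg d b h] with hu
  set w := vec ![h a - h d, h a + h d - (2 : ℝ) • avg a d h] with hw
  have e : ((b : ℝ) - a) * energy Z a b h =
      (((d : ℝ) - a) + ((b : ℝ) - d)) * (energy Z d b h + energy Z a d h) := by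
    rw [← energy_add Z had hdb]; ring
  rw [qf_psiZ, e]
  refine reciprocally_convex (by linarith) (by linarith) (energy_nonneg hZ _ _ _)
    (energy_nonneg hZ _ _ _) ?_ ?_ ?_ ?_ ?_
  · rw [hu, qf_diagZ]
    exact wirtinger_three hZ h hdb (smul_avg hdb h)
  · rw [hw, qf_diagZ]
    exact wirtinger_three hZ h had (smul_avg had h)
  -- Positivity of Ψ on the rescaled vector (s u, t w) is the required family of scalar
  -- inequalities.
  · intro s t
    have := qf_nonneg hΨ (Sum.elim (s • u) (t • w))
    rw [qf_psiZ, qf_smul, qf_smul] at this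
    simpa [Matrix.mulVec_smul, mul_assoc, mul_comm, mul_left_comm] using this
  · intro h0
    -- One of the two windows is a single point, so its vector is zero and the cross term with it.
    have hd : a = d := by exact_mod_cast (by linarith : (a : ℝ) = d)
    have : w = 0 := by
      rw [hw, add_sub_two_smul_eq_zero hd (smul_avg had h), hd, sub_self]
      ext ⟨i, r⟩; fin_cases i <;> rfl
    simp [this]
  · intro h0
    have hd : d = b := by exact_mod_cast (by linarith : (d : ℝ) = b)
    have : u = 0 := by
      rw [hu, add_sub_two_smul_eq_zero hd (smul_avg hdb h), hd, sub_self]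
      ext ⟨i, r⟩; fin_cases i <;> rfl
    simp [this]

end Functionals

/-! ### Φ(d, j) as a bound for the increment of the functional -/

section Decrease

variable {ι : Type*} [Fintype ι] [DecidableEq ι]

/-- The vector on which `Φ(d, 2)` acts; `g` is the history at time `k + 1`. -/
def xiTwo (dn dM d : ℕ) (g : ℕ → ι → ℝ) : Fin 8 → ι → ℝ :=
  ![g 0, g 1, g (dn + 1), g (d + 1), g (dM + 1), avg 0 dn fun l => g (l + 1),
    avg dn d fun l => g (l + 1), avg d dM fun l => g (l + 1)]

/-- The vector on which `Φ(d, 1)` acts; `g` is the history at time `k + 1`. -/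
def xiOne (dm dn dM d : ℕ) (g : ℕ → ι → ℝ) : Fin 10 → ι → ℝ :=
  ![g 0, g 1, g (dm + 1), g (d + 1), g (dn + 1), avg 0 dm fun l => g (l + 1),
    avg dm d fun l => g (l + 1), avg d dn fun l => g (l + 1), g (dM + 1),
    avg dn dM fun l => g (l + 1)]

lemma smul_avg_zero (b : ℕ) (h : ℕ → ι → ℝ) :
    ((b : ℝ) + 1) • avg 0 b h = ∑ l ∈ Finset.Icc 0 b, h l := by
  simpa using smul_avg (Nat.zero_le b) h

/-- The sample at the current delay belongs to both closed windows, so it is counted twice. The -1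
in its column of the third rows of W₁ and W₂ removes the extra copy. -/
lemma split_shift (g : ℕ → ι → ℝ) {a b d : ℕ} (had : a ≤ d) (hdb : d ≤ b) :
    ((d : ℝ) - a + 1) • avg a d (fun l => g (l + 1)) +
      ((b : ℝ) - d + 1) • avg d b (fun l => g (l + 1)) =
      g (d + 1) + ∑ l ∈ Finset.Icc a b, g (l + 1) := by
  rw [smul_avg had, smul_avg hdb, sum_Icc_add_sum_Icc (fun l => g (l + 1)) had hdb]

/-- Removing the oldest sample from the closed windows gives the sums at time k + 1. For W₁ the
newest one is removed instead, which gives the sums at time k. -/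
lemma comb_w2_xiTwo (g : ℕ → ι → ℝ) {dn dM d : ℕ} (hnd : dn ≤ d) (hdM : d ≤ dM) :
    comb (w2 dn dM + wd d) (xiTwo dn dM d g) =
      ![g 0, ∑ l ∈ Finset.Ioc 0 dn, g l, ∑ l ∈ Finset.Ioc dn dM, g l] := by
  have h1 := smul_avg_zero dn fun l => g (l + 1)
  rw [sum_Icc_shift_eq g (Nat.zero_le dn)] at h1
  have h2 := split_shift g hnd hdM
  rw [sum_Icc_shift_eq g (hnd.trans hdM)] at h2
  ext i r
  replace h1 := congrFun h1 r
  replace h2 := congrFun h2 r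
  simp only [Pi.add_apply, Pi.smul_apply, smul_eq_mul, Finset.sum_apply] at h1 h2
  fin_cases i
  · simp [comb, w2, wd, xiTwo, Fin.sum_univ_eight]
  · simp [comb, w2, wd, xiTwo, Fin.sum_univ_eight]; linarith
  · simp [comb, w2, wd, xiTwo, Fin.sum_univ_eight]; linarith

lemma comb_w1_xiTwo (g : ℕ → ι → ℝ) {dn dM d : ℕ} (hnd : dn ≤ d) (hdM : d ≤ dM) :
    comb (w1 dn dM + wd d) (xiTwo dn dM d g) =
      ![g 1, ∑ l ∈ Finset.Ioc 0 dn, g (l + 1), ∑ l ∈ Finset.Ioc dn dM, g (l + 1)] := by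
  have h1 := smul_avg_zero dn fun l => g (l + 1)
  rw [sum_Icc_eq_add_sum_Ioc (fun l => g (l + 1)) (Nat.zero_le dn)] at h1
  have h2 := split_shift g hnd hdM
  rw [sum_Icc_eq_add_sum_Ioc (fun l => g (l + 1)) (hnd.trans hdM)] at h2
  ext i r
  replace h1 := congrFun h1 r
  replace h2 := congrFun h2 r
  simp only [Pi.add_apply, Pi.smul_apply, smul_eq_mul, Finset.sum_apply] at h1 h2
  fin_cases i
  · simp [comb, w1, wd, xiTwo, Fin.sum_univ_eight]
  · simp [comb, w1, wd, xiTwo, Fin.sum_univ_eight]; linarith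
  · simp [comb, w1, wd, xiTwo, Fin.sum_univ_eight]; linarith

lemma comb_w2One_xiOne (g : ℕ → ι → ℝ) {dm dn dM d : ℕ} (hmd : dm ≤ d) (hdn : d ≤ dn)
    (hnM : dn ≤ dM) :
    comb (w2One dm dn ((dM : ℝ) - dn) + wdOne d) (xiOne dm dn dM d g) =
      ![g 0, ∑ l ∈ Finset.Ioc 0 dm, g l, ∑ l ∈ Finset.Ioc dm dn, g l,
        ∑ l ∈ Finset.Ioc dn dM, g l] := by
  have h1 := smul_avg_zero dm fun l => g (l + 1)
  rw [sum_Icc_shift_eq g (Nat.zero_le dm)] at h1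
  have h2 := split_shift g hmd hdn
  rw [sum_Icc_shift_eq g (hmd.trans hdn)] at h2
  have h3 := smul_avg hnM fun l => g (l + 1)
  rw [sum_Icc_shift_eq g hnM] at h3
  ext i r
  replace h1 := congrFun h1 r
  replace h2 := congrFun h2 r
  replace h3 := congrFun h3 r
  simp only [Pi.add_apply, Pi.smul_apply, smul_eq_mul, Finset.sum_apply] at h1 h2 h3
  fin_cases i
  · simp [comb, w2One, wdOne, xiOne, Fin.sum_univ_castSucc]
  · simp [comb, w2One, wdOne, xiOne, Fin.sum_univ_castSucc]; linarith
  · simp [comb, w2One, wdOne, xiOne, Fin.sum_univ_castSucc]; linarith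
  · simp [comb, w2One, wdOne, xiOne, Fin.sum_univ_castSucc]; linarith

lemma comb_w1One_xiOne (g : ℕ → ι → ℝ) {dm dn dM d : ℕ} (hmd : dm ≤ d) (hdn : d ≤ dn)
    (hnM : dn ≤ dM) :
    comb (w1One dm dn ((dM : ℝ) - dn) + wdOne d) (xiOne dm dn dM d g) =
      ![g 1, ∑ l ∈ Finset.Ioc 0 dm, g (l + 1), ∑ l ∈ Finset.Ioc dm dn, g (l + 1),
        ∑ l ∈ Finset.Ioc dn dM, g (l + 1)] := by
  have h1 := smul_avg_zero dm fun l => g (l + 1)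
  rw [sum_Icc_eq_add_sum_Ioc (fun l => g (l + 1)) (Nat.zero_le dm)] at h1
  have h2 := split_shift g hmd hdn
  rw [sum_Icc_eq_add_sum_Ioc (fun l => g (l + 1)) (hmd.trans hdn)] at h2
  have h3 := smul_avg hnM fun l => g (l + 1)
  rw [sum_Icc_eq_add_sum_Ioc (fun l => g (l + 1)) hnM] at h3
  ext i r
  replace h1 := congrFun h1 r
  replace h2 := congrFun h2 r
  replace h3 := congrFun h3 r
  simp only [Pi.add_apply, Pi.smul_apply, smul_eq_mul, Finset.sum_apply] at h1 h2 h3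
  fin_cases i
  · simp [comb, w1One, wdOne, xiOne, Fin.sum_univ_castSucc]
  · simp [comb, w1One, wdOne, xiOne, Fin.sum_univ_castSucc]; linarith
  · simp [comb, w1One, wdOne, xiOne, Fin.sum_univ_castSucc]; linarith
  · simp [comb, w1One, wdOne, xiOne, Fin.sum_univ_castSucc]; linarith

/-- `Φ(d, 2)` bounds the increment of the functional of the second mode. -/
lemma lyapTwo_sub_le {dn dM d : ℕ} (hnd : dn ≤ d) (hdM : d ≤ dM)
    {P : Matrix (Fin 3 × ι) (Fin 3 × ι) ℝ} {Q1 Q2 Z1 Z2 : Matrix ι ι ℝ}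
    {Y : Matrix (Fin 2 × ι) (Fin 2 × ι) ℝ} (hP : P.PosSemidef) (hZ1 : Z1.PosSemidef)
    (hZ2 : Z2.PosSemidef) (hΨ : (psiZ Z2 Y).PosSemidef) (g : ℕ → ι → ℝ) :
    lyapTwo dn dM P Q1 Q2 Z1 Z2 g - lyapTwo dn dM P Q1 Q2 Z1 Z2 (fun l => g (l + 1)) ≤
      qf (phiMode2 dn dM P Q1 Q2 Z1 Z2 Y d) (vec (xiTwo dn dM d g)) := by
  have hnM := hnd.trans hdM
  rw [qf_phiMode2 dn dM hP, comb_w2_xiTwo g hnd hdM, comb_w1_xiTwo g hnd hdM]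
  have q1 := stateSum_sub_shift Q1 (Nat.zero_le dn) g
  have q2 := stateSum_sub_shift Q2 hnM g
  have z1 := incSum_sub_shift Z1 (Nat.zero_le dn) g
  have z2 := incSum_sub_shift Z2 hnM g
  have e1 := wirtinger hZ1 (fun l => g (l + 1)) (Nat.zero_le dn) (smul_avg (Nat.zero_le dn) _)
  have e2 := qf_psiZ_le hZ2 hΨ (fun l => g (l + 1)) hnd hdM
  simp only [zero_add, Nat.cast_zero, sub_zero, tsub_zero] at q1 q2 z1 z2 e1 e2
  simp only [lyapTwo]
  simp only [xiTwo, Matrix.cons_val]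
  simp only [zero_add]
  linarith

/-- `Φ(d, 1)` bounds the increment of the functional of the first mode. -/
lemma lyapOne_sub_le {dm dn dM d : ℕ} (hmd : dm ≤ d) (hdn : d ≤ dn) (hnM : dn ≤ dM)
    {P : Matrix (Fin 4 × ι) (Fin 4 × ι) ℝ} {Q1 Q2 Q3 Z1 Z2 Z3 : Matrix ι ι ℝ}
    {Y : Matrix (Fin 2 × ι) (Fin 2 × ι) ℝ} (hP : P.PosSemidef) (hQ3 : Q3.PosSemidef)
    (hZ1 : Z1.PosSemidef) (hZ2 : Z2.PosSemidef) (hZ3 : Z3.PosSemidef)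
    (hΨ : (psiZ Z2 Y).PosSemidef) (g : ℕ → ι → ℝ) :
    lyapOne dm dn dM P Q1 Q2 Q3 Z1 Z2 Z3 g -
        lyapOne dm dn dM P Q1 Q2 Q3 Z1 Z2 Z3 (fun l => g (l + 1)) ≤
      qf (phiMode1 dm dn dM P Q1 Q2 Q3 Z1 Z2 Z3 Y d) (vec (xiOne dm dn dM d g)) := by
  have hmn := hmd.trans hdn
  rw [qf_phiMode1 dm dn dM hP, comb_w2One_xiOne g hmd hdn hnM, comb_w1One_xiOne g hmd hdn hnM]
  have q1 := stateSum_sub_shift Q1 (Nat.zero_le dm) g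
  have q2 := stateSum_sub_shift Q2 hmn g
  have q3 := stateSum_sub_shift Q3 hnM g
  -- The increment of the Q₃ sum contains minus the form of Q₃ at the oldest sample. Φ(d, 1) omits
  -- this term, so it is discarded by its sign.
  have q4 := qf_nonneg hQ3 (g (dM + 1))
  have z1 := incSum_sub_shift Z1 (Nat.zero_le dm) g
  have z2 := incSum_sub_shift Z2 hmn g
  have z3 := incSum_sub_shift Z3 hnM g
  have e1 := wirtinger hZ1 (fun l => g (l + 1)) (Nat.zero_le dm) (smul_avg (Nat.zero_le dm) _)
  have e2 := qf_psiZ_le hZ2 hΨ (fun l => g (l + 1)) hmd hdn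
  -- The Z₃ block of Φ(d, 1) carries the factor 3 without γ, and this range may be empty.
  have e3 := wirtinger_three hZ3 (fun l => g (l + 1)) hnM (smul_avg hnM _)
  simp only [zero_add, Nat.cast_zero, sub_zero, tsub_zero] at q1 q2 q3 z1 z2 z3 e1 e2 e3
  simp only [lyapOne]
  simp only [xiOne, Matrix.cons_val]
  simp only [zero_add]
  linarith

end Decrease

/-! ### The functionals as quadratic forms in the history -/

section History

variable {ι : Type*} [Fintype ι]

/-- The first `N` blocks of a history. -/
def hist (N : ℕ) (h : ℕ → ι → ℝ) : Fin N × ι → ℝ := vec fun i : Fin N => h i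

lemma qf_flat_hist (N : ℕ) (F : ℕ → ℕ → Matrix ι ι ℝ) (h : ℕ → ι → ℝ) :
    qf (flat (Matrix.of fun i k : Fin N => F i k)) (hist N h) =
      ∑ i ∈ Finset.range N, ∑ k ∈ Finset.range N, h i ⬝ᵥ F i k *ᵥ h k := by
  rw [hist, qf_flat, ← Fin.sum_univ_eq_sum_range
    (fun i => ∑ k ∈ Finset.range N, h i ⬝ᵥ F i k *ᵥ h k)]
  refine Finset.sum_congr rfl fun i _ => ?_
  rw [← Fin.sum_univ_eq_sum_range (fun k => h i ⬝ᵥ F i k *ᵥ h k)]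
  rfl

/-- The block tridiagonal matrix of `∑ w_l (x_l - x_{l+1})ᵀ Z (x_l - x_{l+1})`. -/
def incMat (w : ℕ → ℝ) (Z : Matrix ι ι ℝ) (i k : ℕ) : Matrix ι ι ℝ :=
  if i = k then (w i + if i = 0 then 0 else w (i - 1)) • Z
  else if k = i + 1 then -(w i • Z)
  else if i = k + 1 then -(w k • Z)
  else 0

/-- The last diagonal block also carries w(N), half of an increment that leaves the truncated
history; this is the extra term on the right. It vanishes for the weights used later. The induction
adds one row and one column at a time. -/
lemma sum_incMat (w : ℕ → ℝ) (Z : Matrix ι ι ℝ) (h : ℕ → ι → ℝ) (N : ℕ) :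
    ∑ i ∈ Finset.range (N + 1), ∑ k ∈ Finset.range (N + 1), h i ⬝ᵥ incMat w Z i k *ᵥ h k =
      ∑ l ∈ Finset.range N, w l * qf Z (h l - h (l + 1)) + w N * qf Z (h N) := by
  induction N with
  | zero => simp [incMat, qf, Matrix.smul_mulVec]
  | succ n ih =>
    have h1 : ∑ i ∈ Finset.range (n + 1), h i ⬝ᵥ incMat w Z i (n + 1) *ᵥ h (n + 1) =
        -(w n * (h n ⬝ᵥ Z *ᵥ h (n + 1))) := by
      rw [Finset.sum_eq_single n]
      · simp [incMat, Matrix.neg_mulVec, Matrix.smul_mulVec]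
      · intro i hi hin
        have : i < n + 1 := Finset.mem_range.1 hi
        rw [incMat, if_neg (by omega), if_neg (by omega), if_neg (by omega)]; simp
      · simp
    have h2 : ∑ k ∈ Finset.range (n + 1), h (n + 1) ⬝ᵥ incMat w Z (n + 1) k *ᵥ h k =
        -(w n * (h (n + 1) ⬝ᵥ Z *ᵥ h n)) := by
      rw [Finset.sum_eq_single n]
      · rw [incMat, if_neg (by omega), if_neg (by omega), if_pos rfl]
        simp [Matrix.neg_mulVec, Matrix.smul_mulVec]
      · intro i hi hin
        have : i < n + 1 := Finset.mem_range.1 hi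
        rw [incMat, if_neg (by omega), if_neg (by omega), if_neg (by omega)]; simp
      · simp
    rw [Finset.sum_range_succ, Finset.sum_range_succ (fun k => h (n + 1) ⬝ᵥ _), h2]
    simp only [Finset.sum_range_succ (fun k => h _ ⬝ᵥ incMat w Z _ k *ᵥ h k) (n + 1)]
    rw [Finset.sum_add_distrib, ih, h1, Finset.sum_range_succ _ n]
    simp [incMat, qf, Matrix.smul_mulVec, Matrix.mulVec_sub]
    ring

lemma sum_range_weight (Z : Matrix ι ι ℝ) {a b N : ℕ} (hb : b ≤ N) (h : ℕ → ι → ℝ) :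
    ∑ l ∈ Finset.range N, weight a b l * qf Z (h l - h (l + 1)) = incSum Z a b h := by
  rw [incSum]
  symm
  refine Finset.sum_subset (by simpa using hb) fun l _ hl => ?_
  rw [weight_eq_zero (by simpa using hl), zero_mul]

lemma sum_incMat_weight (Z : Matrix ι ι ℝ) {a b N : ℕ} (hb : b ≤ N) (h : ℕ → ι → ℝ) :
    ∑ i ∈ Finset.range (N + 1), ∑ k ∈ Finset.range (N + 1),
      h i ⬝ᵥ incMat (weight a b) Z i k *ᵥ h k = incSum Z a b h := by
  rw [sum_incMat, sum_range_weight Z hb, weight_eq_zero hb, zero_mul, add_zero]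

/-- The block diagonal matrix with the blocks `D i`. -/
def diagMat (D : ℕ → Matrix ι ι ℝ) (i k : ℕ) : Matrix ι ι ℝ := if i = k then D i else 0

lemma sum_diagMat (D : ℕ → Matrix ι ι ℝ) (h : ℕ → ι → ℝ) (N : ℕ) (h0 : D 0 = 0) :
    ∑ i ∈ Finset.range (N + 1), ∑ k ∈ Finset.range (N + 1), h i ⬝ᵥ diagMat D i k *ᵥ h k =
      ∑ i ∈ Finset.Ioc 0 N, qf (D i) (h i) := by
  have : ∀ i ∈ Finset.range (N + 1),
      ∑ k ∈ Finset.range (N + 1), h i ⬝ᵥ diagMat D i k *ᵥ h k = qf (D i) (h i) := by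
    intro i hi
    rw [Finset.sum_eq_single i]
    · simp [diagMat, qf]
    · intro k _ hk
      simp [diagMat, hk.symm]
    · exact fun h => absurd hi h
  rw [Finset.sum_congr rfl this, show Finset.range (N + 1) = Finset.Icc 0 N by ext; simp,
    sum_Icc_eq_add_sum_Ioc (fun i => qf (D i) (h i)) (Nat.zero_le N), h0]
  simp

/-- Each diagonal block adds the weights of the two neighbouring increments, and each off-diagonal
block is minus one weight. The two entry formulas of H_j come from the weight of Z₂ being constant
up to a and linear afterwards, while that of Z₁ ends at a. Symmetry of Z₁ and Z₂ serves the blocks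
below the diagonal. -/
lemma hMat_eq {Q1 Q2 Z1 Z2 : Matrix ι ι ℝ} (hZ1 : Z1ᵀ = Z1) (hZ2 : Z2ᵀ = Z2) {a b i k : ℕ}
    (hab : a ≤ b) (hi : i ≤ b) (hk : k ≤ b) :
    hMat a b Q1 Q2 Z1 Z2 i k =
      diagMat (fun i => if i = 0 then 0 else if i ≤ a then Q1 else Q2) i k +
        incMat (weight 0 a) Z1 i k + incMat (weight a b) Z2 i k := by
  have off : ∀ j, j + 1 ≤ b → (if j + 1 ≤ a then
      -(((b : ℝ) - a) ^ 2 • Z2) - ((a : ℝ) * (a - (j + 1 : ℕ) + 1)) • Z1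
      else -((((b : ℝ) - a) * ((b : ℝ) - a - (j + 1 - a : ℕ) + 1)) • Z2)) =
      -(weight 0 a j • Z1) + -(weight a b j • Z2) := by
    intro j hj
    split_ifs with h
    · rw [weight_of_ge (Nat.zero_le j) (by omega), weight_of_le hab (by omega)]
      push_cast; module
    · rw [weight_eq_zero (by omega), weight_of_ge (by omega) (by omega), Nat.cast_sub (by omega)]
      push_cast; module
  simp only [hMat, hFormat, diagMat, incMat]
  split_ifs with h1 h2 h3 h4 h5 h6 h7
  · subst h1; subst h2
    rw [weight_of_le (Nat.zero_le _) le_rfl, weight_of_le hab (Nat.zero_le _)]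
    push_cast; module
  · subst h1
    obtain ⟨j, rfl⟩ := Nat.exists_eq_succ_of_ne_zero h2
    rw [Nat.succ_eq_add_one, Nat.add_sub_cancel, weight_of_ge (Nat.zero_le _) h3,
      weight_of_ge (Nat.zero_le _) (by omega), weight_of_le hab h3, weight_of_le hab (by omega)]
    push_cast; module
  · subst h1
    obtain ⟨j, rfl⟩ := Nat.exists_eq_succ_of_ne_zero h2
    rw [Nat.succ_eq_add_one, Nat.add_sub_cancel, weight_eq_zero (by omega),
      weight_eq_zero (by omega), weight_of_ge (by omega) (by omega),
      weight_of_ge (by omega) (by omega), Nat.cast_sub (by omega)]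
    push_cast; module
  · subst h4
    rw [zero_add, ← off i hk, if_pos h5]
  · subst h4
    rw [zero_add, ← off i hk, if_neg h5]
  · subst h6
    rw [zero_add, ← off k hi, if_pos h7]
    simp [hZ1, hZ2]
  · subst h6
    rw [zero_add, ← off k hi, if_neg h7]
    simp [hZ2]
  · simp

lemma haMat_eq {Z : Matrix ι ι ℝ} (hZ : Zᵀ = Z) {b dM i k : ℕ} (hb : b ≤ dM) (hi : i ≤ dM)
    (hk : k ≤ dM) : haMat b dM Z i k = incMat (weight b dM) Z i k := by
  have off : ∀ j, j + 1 ≤ dM → (if j + 1 ≤ b then -(((dM : ℝ) - b) ^ 2 • Z)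
      else -((((dM : ℝ) - b) * ((dM : ℝ) - b - (j + 1 - b : ℕ) + 1)) • Z)) =
      -(weight b dM j • Z) := by
    intro j hj
    split_ifs with h
    · rw [weight_of_le hb (by omega)]
    · rw [weight_of_ge (by omega) (by omega), Nat.cast_sub (by omega)]
      push_cast; module
  simp only [haMat, hFormat, incMat]
  split_ifs with h1 h2 h3 h4 h5 h6 h7
  · subst h2
    rw [weight_of_le hb (Nat.zero_le _)]
    module
  · obtain ⟨j, rfl⟩ := Nat.exists_eq_succ_of_ne_zero h2
    rw [Nat.succ_eq_add_one, Nat.add_sub_cancel, weight_of_le hb h3, weight_of_le hb (by omega)]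
    module
  · obtain ⟨j, rfl⟩ := Nat.exists_eq_succ_of_ne_zero h2
    rw [Nat.succ_eq_add_one, Nat.add_sub_cancel, weight_of_ge (by omega) (by omega),
      weight_of_ge (by omega) (by omega), Nat.cast_sub (by omega)]
    push_cast; module
  · subst h4
    rw [← off i hk, if_pos h5]
  · subst h4
    rw [← off i hk, if_neg h5]
  · subst h6
    rw [← off k hi, if_pos h7]
    simp [hZ]
  · subst h6
    rw [← off k hi, if_neg h7]
    simp [hZ]
  · rfl

/-- Increments older than b have weight zero. So cutting H₁ off after the block d_n inside S₁ loses
nothing. -/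
lemma incMat_weight_eq_zero (Z : Matrix ι ι ℝ) {a b i k : ℕ} (h : ¬(i ≤ b ∧ k ≤ b)) :
    incMat (weight a b) Z i k = 0 := by
  unfold incMat
  split_ifs with h1 h2 h3 h4
  · omega
  · rw [weight_eq_zero (by omega), weight_eq_zero (by omega)]; simp
  · rw [weight_eq_zero (by omega)]; simp
  · rw [weight_eq_zero (by omega)]; simp
  · rfl

/-- A sum of Iverson brackets over the first `N + 1` blocks. -/
lemma sum_fin_ite_smul (N : ℕ) (p : ℕ → Prop) [DecidablePred p] (h : ℕ → ι → ℝ) :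
    ∑ k : Fin (N + 1), (if p k then (1 : ℝ) else 0) • h k =
      ∑ k ∈ (Finset.range (N + 1)).filter p, h k := by
  rw [Fin.sum_univ_eq_sum_range (fun k => (if p k then (1 : ℝ) else 0) • h k), Finset.sum_filter]
  refine Finset.sum_congr rfl fun k _ => ?_
  split_ifs <;> simp

lemma comb_w5Two {dn dM : ℕ} (hnM : dn ≤ dM) (h : ℕ → ι → ℝ) :
    comb (w5Two dn dM) (fun i => h i) =
      ![h 0, ∑ l ∈ Finset.Ioc 0 dn, h l, ∑ l ∈ Finset.Ioc dn dM, h l] := by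
  funext i
  fin_cases i
  · refine (sum_fin_ite_smul dM (fun k => k = 0) h).trans ?_
    simp [Finset.filter_eq']
  · refine (sum_fin_ite_smul dM (fun k => 1 ≤ k ∧ k ≤ dn) h).trans
      (Finset.sum_congr (s₂ := Finset.Ioc 0 dn) ?_ fun _ _ => rfl)
    ext; simp; omega
  · refine (sum_fin_ite_smul dM (fun k => dn < k) h).trans
      (Finset.sum_congr (s₂ := Finset.Ioc dn dM) ?_ fun _ _ => rfl)
    ext; simp; omega

lemma comb_w5One {dm dn dM : ℕ} (hmn : dm ≤ dn) (hnM : dn ≤ dM) (h : ℕ → ι → ℝ) :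
    comb (w5One dm dn dM) (fun i => h i) =
      ![h 0, ∑ l ∈ Finset.Ioc 0 dm, h l, ∑ l ∈ Finset.Ioc dm dn, h l,
        ∑ l ∈ Finset.Ioc dn dM, h l] := by
  funext i
  fin_cases i
  · refine (sum_fin_ite_smul dM (fun k => k = 0) h).trans ?_
    simp [Finset.filter_eq']
  · refine (sum_fin_ite_smul dM (fun k => 1 ≤ k ∧ k ≤ dm) h).trans
      (Finset.sum_congr (s₂ := Finset.Ioc 0 dm) ?_ fun _ _ => rfl)
    ext; simp; omega
  · refine (sum_fin_ite_smul dM (fun k => dm < k ∧ k ≤ dn) h).trans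
      (Finset.sum_congr (s₂ := Finset.Ioc dm dn) ?_ fun _ _ => rfl)
    ext; simp; omega
  · refine (sum_fin_ite_smul dM (fun k => dn < k) h).trans
      (Finset.sum_congr (s₂ := Finset.Ioc dn dM) ?_ fun _ _ => rfl)
    ext; simp; omega

variable [DecidableEq ι]

/-- This makes the linking inequalities, stated for S_j, comparable with the decrease obtained from
Φ, which concerns the functionals. -/
lemma qf_sTwo {dn dM : ℕ} (hnM : dn ≤ dM) (P : Matrix (Fin 3 × ι) (Fin 3 × ι) ℝ)
    (Q1 Q2 : Matrix ι ι ℝ) {Z1 Z2 : Matrix ι ι ℝ} (hZ1 : Z1ᵀ = Z1) (hZ2 : Z2ᵀ = Z2)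
    (h : ℕ → ι → ℝ) :
    qf (sTwo dn dM P Q1 Q2 Z1 Z2) (hist (dM + 1) h) = lyapTwo dn dM P Q1 Q2 Z1 Z2 h := by
  have e : ∀ i ∈ Finset.range (dM + 1), ∀ k ∈ Finset.range (dM + 1),
      h i ⬝ᵥ hMat dn dM Q1 Q2 Z1 Z2 i k *ᵥ h k =
      h i ⬝ᵥ diagMat (fun i => if i = 0 then 0 else if i ≤ dn then Q1 else Q2) i k *ᵥ h k +
        h i ⬝ᵥ incMat (weight 0 dn) Z1 i k *ᵥ h k +
        h i ⬝ᵥ incMat (weight dn dM) Z2 i k *ᵥ h k := by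
    intro i hi k hk
    rw [Finset.mem_range, Nat.lt_succ_iff] at hi hk
    rw [hMat_eq hZ1 hZ2 hnM hi hk]
    simp only [Matrix.add_mulVec, dotProduct_add]
  rw [sTwo, qf_add_left, qf_conj, qf_flat_hist,
    Finset.sum_congr rfl fun i hi => Finset.sum_congr rfl (e i hi)]
  simp only [Finset.sum_add_distrib]
  rw [sum_diagMat _ _ _ (by simp), sum_incMat_weight Z1 hnM, sum_incMat_weight Z2 le_rfl, hist,
    scal_mulVec_vec, comb_w5Two hnM, lyapTwo,
    ← Finset.sum_Ioc_consecutive _ (Nat.zero_le dn) hnM]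
  have s1 : ∑ i ∈ Finset.Ioc 0 dn, qf (if i = 0 then 0 else if i ≤ dn then Q1 else Q2) (h i) =
      stateSum Q1 0 dn h :=
    Finset.sum_congr rfl fun i hi => by
      rw [Finset.mem_Ioc] at hi
      rw [if_neg (by omega), if_pos (by omega)]
  have s2 : ∑ i ∈ Finset.Ioc dn dM, qf (if i = 0 then 0 else if i ≤ dn then Q1 else Q2) (h i) =
      stateSum Q2 dn dM h :=
    Finset.sum_congr rfl fun i hi => by
      rw [Finset.mem_Ioc] at hi
      rw [if_neg (by omega), if_neg (by omega)]
  rw [s1, s2]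
  ring

lemma qf_sOne {dm dn dM : ℕ} (hmn : dm ≤ dn) (hnM : dn ≤ dM)
    (P : Matrix (Fin 4 × ι) (Fin 4 × ι) ℝ) (Q1 Q2 Q3 : Matrix ι ι ℝ) {Z1 Z2 Z3 : Matrix ι ι ℝ}
    (hZ1 : Z1ᵀ = Z1) (hZ2 : Z2ᵀ = Z2) (hZ3 : Z3ᵀ = Z3) (h : ℕ → ι → ℝ) :
    qf (sOne dm dn dM P Q1 Q2 Q3 Z1 Z2 Z3) (hist (dM + 1) h) =
      lyapOne dm dn dM P Q1 Q2 Q3 Z1 Z2 Z3 h := by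
  have e : ∀ i ∈ Finset.range (dM + 1), ∀ k ∈ Finset.range (dM + 1),
      h i ⬝ᵥ ((if i ≤ dn ∧ k ≤ dn then hMat dm dn Q1 Q2 Z1 Z2 i k else if i = k then Q3 else 0) +
        haMat dn dM Z3 i k) *ᵥ h k =
      h i ⬝ᵥ diagMat (fun i => if i = 0 then 0 else if i ≤ dm then Q1 else
        if i ≤ dn then Q2 else Q3) i k *ᵥ h k +
        h i ⬝ᵥ incMat (weight 0 dm) Z1 i k *ᵥ h k +
        h i ⬝ᵥ incMat (weight dm dn) Z2 i k *ᵥ h k +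
        h i ⬝ᵥ incMat (weight dn dM) Z3 i k *ᵥ h k := by
    intro i hi k hk
    rw [Finset.mem_range, Nat.lt_succ_iff] at hi hk
    rw [haMat_eq hZ3 hnM hi hk]
    split_ifs with h1 h2
    · rw [hMat_eq hZ1 hZ2 hmn h1.1 h1.2]
      simp only [diagMat, h1.1, if_true, Matrix.add_mulVec, dotProduct_add]
    · rw [incMat_weight_eq_zero Z1 (by omega), incMat_weight_eq_zero Z2 h1]
      simp only [diagMat, Matrix.add_mulVec, dotProduct_add]
      rw [if_pos h2, if_neg (by omega), if_neg (by omega), if_neg (by omega)]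
      simp
    · rw [incMat_weight_eq_zero Z1 (by omega), incMat_weight_eq_zero Z2 h1]
      simp [diagMat, h2]
  -- Equality of `Fin` indices becomes equality of naturals, so that the blocks form a family
  -- indexed by ℕ.
  simp only [sOne, Fin.ext_iff]
  rw [qf_add_left, qf_conj, qf_flat_hist (dM + 1) (fun i k =>
      (if i ≤ dn ∧ k ≤ dn then hMat dm dn Q1 Q2 Z1 Z2 i k else if i = k then Q3 else 0) +
        haMat dn dM Z3 i k),
    Finset.sum_congr rfl fun i hi => Finset.sum_congr rfl (e i hi)]
  simp only [Finset.sum_add_distrib]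
  rw [sum_diagMat _ _ _ (by simp), sum_incMat_weight Z1 (hmn.trans hnM), sum_incMat_weight Z2 hnM,
    sum_incMat_weight Z3 le_rfl, hist, scal_mulVec_vec, comb_w5One hmn hnM, lyapOne,
    ← Finset.sum_Ioc_consecutive _ (Nat.zero_le dn) hnM,
    ← Finset.sum_Ioc_consecutive _ (Nat.zero_le dm) hmn]
  have s1 : ∑ i ∈ Finset.Ioc 0 dm, qf (if i = 0 then 0 else if i ≤ dm then Q1 else
      if i ≤ dn then Q2 else Q3) (h i) = stateSum Q1 0 dm h :=
    Finset.sum_congr rfl fun i hi => by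
      rw [Finset.mem_Ioc] at hi
      rw [if_neg (by omega), if_pos (by omega)]
  have s2 : ∑ i ∈ Finset.Ioc dm dn, qf (if i = 0 then 0 else if i ≤ dm then Q1 else
      if i ≤ dn then Q2 else Q3) (h i) = stateSum Q2 dm dn h :=
    Finset.sum_congr rfl fun i hi => by
      rw [Finset.mem_Ioc] at hi
      rw [if_neg (by omega), if_neg (by omega), if_pos (by omega)]
  have s3 : ∑ i ∈ Finset.Ioc dn dM, qf (if i = 0 then 0 else if i ≤ dm then Q1 else
      if i ≤ dn then Q2 else Q3) (h i) = stateSum Q3 dn dM h :=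
    Finset.sum_congr rfl fun i hi => by
      rw [Finset.mem_Ioc] at hi
      rw [if_neg (by omega), if_neg (by omega), if_neg (by omega)]
  rw [s1, s2, s3]
  ring

/-! ### The inequalities linking the two modes -/

lemma qf_flat_diagLast {N : ℕ} (S : Matrix (Fin N × ι) (Fin N × ι) ℝ) (g : ℕ → ι → ℝ) :
    qf (flat (diagLast (blocks S))) (hist (N + 1) g) = qf S (hist N g) := by
  have hS : S = flat (blocks S) := rfl
  rw [hist, hist, qf_flat, Fin.sum_univ_castSucc]
  conv_rhs => rw [hS, qf_flat]
  simp [diagLast, Fin.sum_univ_castSucc]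

lemma qf_flat_diagFirst {N : ℕ} (S : Matrix (Fin N × ι) (Fin N × ι) ℝ) (g : ℕ → ι → ℝ) :
    qf (flat (diagFirst (blocks S))) (hist (N + 1) g) = qf S (hist N fun l => g (l + 1)) := by
  have hS : S = flat (blocks S) := rfl
  rw [hist, hist, qf_flat, Fin.sum_univ_succ]
  conv_rhs => rw [hS, qf_flat]
  simp [diagFirst, Fin.sum_univ_succ]

/-- Of N + 1 consecutive samples, the first N are the history at time k + 1 and the last N the
history at time k. The form thus compares one functional after the step with the other before it. -/
lemma qf_edge {N : ℕ} (S S' : Matrix (Fin N × ι) (Fin N × ι) ℝ) (g : ℕ → ι → ℝ) :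
    qf (edge S S') (hist (N + 1) g) = qf S (hist N g) - qf S' (hist N fun l => g (l + 1)) := by
  rw [edge, qf_sub_left, qf_flat_diagLast, qf_flat_diagFirst]

lemma barL_mulVec_hist {dn dM l : ℕ} (hnM : dn ≤ dM) (hl : l ≤ dM) (J A An Ad : Matrix ι ι ℝ)
    (g : ℕ → ι → ℝ) :
    barL dn dM J A An Ad l *ᵥ hist (dM + 2) g =
      vec fun _ => -(Jᵀ *ᵥ g 0) + A *ᵥ g 1 + An *ᵥ g (dn + 1) + Ad *ᵥ g (l + 1) := by
  have single : ∀ (M : Matrix ι ι ℝ) (c : ℕ), c < dM + 2 →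
      ∑ k : Fin (dM + 2), (if (k : ℕ) = c then M else 0) *ᵥ g k = M *ᵥ g c := by
    intro M c hc
    rw [Finset.sum_eq_single ⟨c, hc⟩]
    · simp
    · intro k _ hk
      rw [if_neg fun h => hk (Fin.ext h), Matrix.zero_mulVec]
    · simp
  rw [barL, hist, flat_mulVec_vec]
  congr 1
  funext i
  simp only [Matrix.of_apply, Matrix.add_mulVec, Finset.sum_add_distrib]
  rw [single _ 0 (by omega), single _ 1 (by omega), single _ (dn + 1) (by omega),
    single _ (l + 1) (by omega), Matrix.neg_mulVec]

/-- The multiplier term vanishes along the implicit closed-loop equation. -/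
lemma qf_multiplier_eq_zero {dn dM l : ℕ} (hnM : dn ≤ dM) (hl : l ≤ dM) (ε : ℝ)
    {J A An Ad : Matrix ι ι ℝ} {g : ℕ → ι → ℝ}
    (hg : Jᵀ *ᵥ g 0 = A *ᵥ g 1 + An *ᵥ g (dn + 1) + Ad *ᵥ g (l + 1)) :
    qf (He ((multI ι dM ε)ᵀ * barL dn dM J A An Ad l)) (hist (dM + 2) g) = 0 := by
  have h0 : barL dn dM J A An Ad l *ᵥ hist (dM + 2) g = 0 := by
    rw [barL_mulVec_hist hnM hl, hg]
    ext p; simp [vec]; ring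
  rw [qf_He, qf, ← Matrix.mulVec_mulVec, h0]
  simp

end History

/-! ### Decrease of the functionals -/

lemma exists_uniform_qf_le {a κ : Type*} [Fintype a] (s : Finset κ) (M : κ → Matrix a a ℝ)
    (hM : ∀ l ∈ s, NegDef (M l)) :
    ∃ c : ℝ, 0 < c ∧ ∀ l ∈ s, ∀ x, qf (M l) x ≤ -(c * ‖x‖ ^ 2) := by
  classical
  induction s using Finset.induction_on with
  | empty => exact ⟨1, one_pos, by simp⟩
  | insert l s _ ih =>
    obtain ⟨c, hc, h⟩ := ih fun l hl => hM l (Finset.mem_insert_of_mem hl)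
    obtain ⟨c', hc', h'⟩ := exists_qf_le_of_negDef (hM l (Finset.mem_insert_self l s))
    refine ⟨min c c', lt_min hc hc', fun j hj x => ?_⟩
    have h1 := mul_le_mul_of_nonneg_right (min_le_left c c') (sq_nonneg ‖x‖)
    have h2 := mul_le_mul_of_nonneg_right (min_le_right c c') (sq_nonneg ‖x‖)
    rcases Finset.mem_insert.1 hj with rfl | hj
    · linarith [h' x]
    · linarith [h j hj x]

lemma norm_le_norm_vec {a ι : Type*} [Fintype a] [Fintype ι] (X : a → ι → ℝ) (i : a) :
    ‖X i‖ ≤ ‖vec X‖ :=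
  (pi_norm_le_iff_of_nonneg (norm_nonneg _)).2 fun r => norm_le_pi_norm (vec X) (i, r)

section Decrease

variable {ι : Type*} [Fintype ι] [DecidableEq ι]

/-- Ῡ vanishes on the trajectory vector, so the bound at the two end delays is one on Φ alone and
passes to every delay between them. The gain is measured only by the block of z(k). -/
lemma exists_lyapOne_decrease {dm dn dM : ℕ} (hnM : dn ≤ dM) {ε : ℝ}
    {P : Matrix (Fin 4 × ι) (Fin 4 × ι) ℝ} {Q1 Q2 Q3 Z1 Z2 Z3 : Matrix ι ι ℝ}
    {Y : Matrix (Fin 2 × ι) (Fin 2 × ι) ℝ} {J A An Ad : Matrix ι ι ℝ} (hP : P.PosSemidef)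
    (hQ3 : Q3.PosSemidef) (hZ1 : Z1.PosSemidef) (hZ2 : Z2.PosSemidef) (hZ3 : Z3.PosSemidef)
    (hΨ : (psiZ Z2 Y).PosSemidef)
    (hm : NegDef (phiMode1 dm dn dM P Q1 Q2 Q3 Z1 Z2 Z3 Y dm + upsilon 10 ε J A 0 Ad An))
    (hM : NegDef (phiMode1 dm dn dM P Q1 Q2 Q3 Z1 Z2 Z3 Y dn + upsilon 10 ε J A 0 Ad An)) :
    ∃ c : ℝ, 0 < c ∧ ∀ d, dm ≤ d → d ≤ dn → ∀ g : ℕ → ι → ℝ,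
      Jᵀ *ᵥ g 0 = A *ᵥ g 1 + An *ᵥ g (dn + 1) + Ad *ᵥ g (d + 1) →
      lyapOne dm dn dM P Q1 Q2 Q3 Z1 Z2 Z3 g ≤
        lyapOne dm dn dM P Q1 Q2 Q3 Z1 Z2 Z3 (fun l => g (l + 1)) - c * ‖g 1‖ ^ 2 := by
  obtain ⟨c, hc, h⟩ := exists_uniform_qf_le {dm, dn}
    (fun d => phiMode1 dm dn dM P Q1 Q2 Q3 Z1 Z2 Z3 Y d + upsilon 10 ε J A 0 Ad An) (by
      simpa using ⟨hm, hM⟩)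
  refine ⟨c, hc, fun d hmd hdn g hg => ?_⟩
  set x := vec (xiOne dm dn dM d g)
  have hU : qf (upsilon 10 ε J A 0 Ad An) x = 0 := by
    refine (qf_upsilon 5 ε J A 0 Ad An (xiOne dm dn dM d g)).trans ?_
    have : -(Jᵀ *ᵥ g 0) + A *ᵥ g 1 + (0 : Matrix ι ι ℝ) *ᵥ g (dm + 1) + Ad *ᵥ g (d + 1) +
        An *ᵥ g (dn + 1) = 0 := by
      rw [hg, Matrix.zero_mulVec]; abel
    refine (congrArg (fun y => 2 * ((g 0 + ε • g 1) ⬝ᵥ y)) this).trans ?_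
    simp
  have hx : ‖g 1‖ ^ 2 ≤ ‖x‖ ^ 2 :=
    pow_le_pow_left₀ (norm_nonneg _) (norm_le_norm_vec (xiOne dm dn dM d g) 1) 2
  have hcx := mul_le_mul_of_nonneg_left hx hc.le
  -- The vector x is built from the actual delay and stays fixed; only the matrix argument of Φ is
  -- moved to the ends of the range.
  obtain ⟨c₀, c₁, hφ⟩ := exists_qf_phiMode1_eq dm dn dM P Q1 Q2 Q3 Z1 Z2 Z3 Y x
  have h1 := h dm (by simp) x
  have h2 := h dn (by simp) x
  rw [qf_add_left, hU, hφ, add_zero] at h1 h2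
  have h3 := affine_le (Nat.cast_le.2 hmd) (Nat.cast_le.2 hdn) h1 h2
  rw [← hφ] at h3
  have h4 := lyapOne_sub_le (Q1 := Q1) (Q2 := Q2) hmd hdn hnM hP hQ3 hZ1 hZ2 hZ3 hΨ g
  linarith

lemma exists_lyapTwo_decrease {dn dM : ℕ} {ε : ℝ}
    {P : Matrix (Fin 3 × ι) (Fin 3 × ι) ℝ} {Q1 Q2 Z1 Z2 : Matrix ι ι ℝ}
    {Y : Matrix (Fin 2 × ι) (Fin 2 × ι) ℝ} {J A An Ad : Matrix ι ι ℝ} (hP : P.PosSemidef)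
    (hZ1 : Z1.PosSemidef) (hZ2 : Z2.PosSemidef) (hΨ : (psiZ Z2 Y).PosSemidef)
    (hm : NegDef (phiMode2 dn dM P Q1 Q2 Z1 Z2 Y dn + upsilon 8 ε J A An Ad 0))
    (hM : NegDef (phiMode2 dn dM P Q1 Q2 Z1 Z2 Y dM + upsilon 8 ε J A An Ad 0)) :
    ∃ c : ℝ, 0 < c ∧ ∀ d, dn ≤ d → d ≤ dM → ∀ g : ℕ → ι → ℝ,
      Jᵀ *ᵥ g 0 = A *ᵥ g 1 + An *ᵥ g (dn + 1) + Ad *ᵥ g (d + 1) →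
      lyapTwo dn dM P Q1 Q2 Z1 Z2 g ≤
        lyapTwo dn dM P Q1 Q2 Z1 Z2 (fun l => g (l + 1)) - c * ‖g 1‖ ^ 2 := by
  obtain ⟨c, hc, h⟩ := exists_uniform_qf_le {dn, dM}
    (fun d => phiMode2 dn dM P Q1 Q2 Z1 Z2 Y d + upsilon 8 ε J A An Ad 0) (by
      simpa using ⟨hm, hM⟩)
  refine ⟨c, hc, fun d hnd hdM g hg => ?_⟩
  set x := vec (xiTwo dn dM d g)
  have hU : qf (upsilon 8 ε J A An Ad 0) x = 0 := by
    refine (qf_upsilon 3 ε J A An Ad 0 (xiTwo dn dM d g)).trans ?_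
    have : -(Jᵀ *ᵥ g 0) + A *ᵥ g 1 + An *ᵥ g (dn + 1) + Ad *ᵥ g (d + 1) +
        (0 : Matrix ι ι ℝ) *ᵥ g (dM + 1) = 0 := by
      rw [hg, Matrix.zero_mulVec]; abel
    refine (congrArg (fun y => 2 * ((g 0 + ε • g 1) ⬝ᵥ y)) this).trans ?_
    simp
  have hx : ‖g 1‖ ^ 2 ≤ ‖x‖ ^ 2 :=
    pow_le_pow_left₀ (norm_nonneg _) (norm_le_norm_vec (xiTwo dn dM d g) 1) 2
  have hcx := mul_le_mul_of_nonneg_left hx hc.le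
  obtain ⟨c₀, c₁, hφ⟩ := exists_qf_phiMode2_eq dn dM P Q1 Q2 Z1 Z2 Y x
  have h1 := h dn (by simp) x
  have h2 := h dM (by simp) x
  rw [qf_add_left, hU, hφ, add_zero] at h1 h2
  have h3 := affine_le (Nat.cast_le.2 hnd) (Nat.cast_le.2 hdM) h1 h2
  rw [← hφ] at h3
  have h4 := lyapTwo_sub_le (Q1 := Q1) (Q2 := Q2) hnd hdM hP hZ1 hZ2 hΨ g
  linarith

/-- Here every delay of the range has its own inequality, so no convexity is involved; finiteness of
the range gives a common constant. -/
lemma exists_edge_decrease {dn dM a b : ℕ} (hnM : dn ≤ dM) (hb : b ≤ dM) {ε : ℝ}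
    {S S' : Matrix (Fin (dM + 1) × ι) (Fin (dM + 1) × ι) ℝ} {J A An Ad : Matrix ι ι ℝ}
    (hE : ∀ l : ℕ, a ≤ l → l ≤ b →
      NegDef (edge S S' + He ((multI ι dM ε)ᵀ * barL dn dM J A An Ad l))) :
    ∃ c : ℝ, 0 < c ∧ ∀ d, a ≤ d → d ≤ b → ∀ g : ℕ → ι → ℝ,
      Jᵀ *ᵥ g 0 = A *ᵥ g 1 + An *ᵥ g (dn + 1) + Ad *ᵥ g (d + 1) →
      qf S (hist (dM + 1) g) ≤
        qf S' (hist (dM + 1) fun l => g (l + 1)) - c * ‖g 1‖ ^ 2 := by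
  obtain ⟨c, hc, h⟩ := exists_uniform_qf_le (Finset.Icc a b) _ fun l hl =>
    hE l (Finset.mem_Icc.1 hl).1 (Finset.mem_Icc.1 hl).2
  refine ⟨c, hc, fun d had hdb g hg => ?_⟩
  have h1 := h d (Finset.mem_Icc.2 ⟨had, hdb⟩) (hist (dM + 2) g)
  rw [qf_add_left, qf_multiplier_eq_zero hnM (hdb.trans hb) ε hg, qf_edge, add_zero] at h1
  have hx : ‖g 1‖ ^ 2 ≤ ‖hist (dM + 2) g‖ ^ 2 :=
    pow_le_pow_left₀ (norm_nonneg _)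
      (norm_le_norm_vec (fun i : Fin (dM + 2) => g i) ⟨1, by omega⟩) 2
  have hcx := mul_le_mul_of_nonneg_left hx hc.le
  linarith

end Decrease

/-! ### From a decreasing functional to asymptotic stability -/

section Stability

variable {ι : Type*} [Fintype ι]

lemma exists_forall_qf_hist_lt (N : ℕ) (S : Matrix (Fin N × ι) (Fin N × ι) ℝ) {ρ : ℝ}
    (hρ : 0 < ρ) :
    ∃ δ : ℝ, 0 < δ ∧ ∀ h : ℕ → ι → ℝ, (∀ i < N, ‖h i‖ < δ) → qf S (hist N h) < ρ := by
  have hc := (continuous_qf S).tendsto 0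
  rw [qf_zero] at hc
  obtain ⟨δ, hδ, h⟩ := Metric.eventually_nhds_iff.1 (hc.eventually_lt_const hρ)
  refine ⟨δ, hδ, fun g hg => h ?_⟩
  rw [dist_zero_right, pi_norm_lt_iff hδ]
  exact fun p => (norm_le_pi_norm (g p.1) p.2).trans_lt (hg p.1 p.1.2)

lemma exists_forall_norm_mulVec_lt {κ : Type*} [Fintype κ] (M : Matrix κ ι ℝ) {r : ℝ}
    (hr : 0 < r) : ∃ δ : ℝ, 0 < δ ∧ ∀ x : ι → ℝ, ‖x‖ < δ → ‖M *ᵥ x‖ < r := by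
  have hc : Tendsto (fun x : ι → ℝ => ‖M *ᵥ x‖) (𝓝 0) (𝓝 0) := by
    have : Continuous fun x : ι → ℝ => ‖M *ᵥ x‖ := by fun_prop
    simpa using this.tendsto 0
  obtain ⟨δ, hδ, h⟩ := Metric.eventually_nhds_iff.1 (hc.eventually_lt_const hr)
  exact ⟨δ, hδ, fun x hx => h (by rwa [dist_zero_right])⟩

/-- `z` solves `Jᵀ z(k+1) = A z(k) + Aₙ z(k - dₙ) + A_d z(k - d(k))` for all `k ≥ 0`. -/
def IsImplicitSolution (J A An Ad : Matrix ι ι ℝ) (dn : ℕ) (d : ℕ → ℕ) (z : ℤ → ι → ℝ) : Prop :=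
  ∀ k : ℕ, Jᵀ *ᵥ z ((k : ℤ) + 1) =
    A *ᵥ z (k : ℤ) + An *ᵥ z ((k : ℤ) - (dn : ℤ)) + Ad *ᵥ z ((k : ℤ) - (d k : ℤ))

/-- A nonnegative functional with a quadratic decrease along one trajectory. -/
lemma norm_sq_le_and_tendsto_of_decrease {v : ℕ → ℝ} {z : ℕ → ι → ℝ} {c : ℝ} (hc : 0 < c)
    (hv : ∀ k, 0 ≤ v k) (hdec : ∀ k, v (k + 1) ≤ v k - c * ‖z k‖ ^ 2) :
    (∀ k, c * ‖z k‖ ^ 2 ≤ v 0) ∧ Tendsto z atTop (𝓝 0) := by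
  have hsum : ∀ n, ∑ k ∈ Finset.range n, c * ‖z k‖ ^ 2 ≤ v 0 - v n := by
    intro n
    induction n with
    | zero => simp
    | succ n ih => rw [Finset.sum_range_succ]; linarith [hdec n]
  have hpos : ∀ k, 0 ≤ c * ‖z k‖ ^ 2 := fun k => by positivity
  refine ⟨fun k => ?_, ?_⟩
  · have h1 := hsum (k + 1)
    rw [Finset.sum_range_succ] at h1
    have h2 := Finset.sum_nonneg fun i (_ : i ∈ Finset.range k) => hpos i
    linarith [hv (k + 1)]
  · have hs : Summable fun k => c * ‖z k‖ ^ 2 :=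
      summable_of_sum_range_le (c := v 0) hpos fun n => by linarith [hsum n, hv n]
    have h1 := hs.tendsto_atTop_zero.const_mul c⁻¹
    have h2 : Tendsto (fun k => ‖z k‖ ^ 2) atTop (𝓝 0) := by
      simpa [inv_mul_cancel_left₀ hc.ne'] using h1
    have h3 := h2.sqrt
    rw [tendsto_zero_iff_norm_tendsto_zero]
    simpa [Real.sqrt_sq (norm_nonneg _)] using h3

/-- A pair of nonnegative quadratic functionals whose minimum decreases yields asymptotic
stability of the implicit delay system. -/
lemma implicit_asympStable {J A An Ad : Matrix ι ι ℝ} {dn dM : ℕ} {d : ℕ → ℕ} {c : ℝ} (hc : 0 < c)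
    (S S' : Matrix (Fin (dM + 1) × ι) (Fin (dM + 1) × ι) ℝ)
    (hS : ∀ h, 0 ≤ qf S (hist (dM + 1) h)) (hS' : ∀ h, 0 ≤ qf S' (hist (dM + 1) h))
    (hdec : ∀ (k : ℕ) (g : ℕ → ι → ℝ),
      Jᵀ *ᵥ g 0 = A *ᵥ g 1 + An *ᵥ g (dn + 1) + Ad *ᵥ g (d k + 1) →
      min (qf S (hist (dM + 1) g)) (qf S' (hist (dM + 1) g)) ≤
        min (qf S (hist (dM + 1) fun l => g (l + 1))) (qf S' (hist (dM + 1) fun l => g (l + 1))) -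
          c * ‖g 1‖ ^ 2) :
    (∀ r : ℝ, 0 < r → ∃ δ : ℝ, 0 < δ ∧ ∀ z : ℤ → ι → ℝ, IsImplicitSolution J A An Ad dn d z →
      (∀ i : ℕ, i ≤ dM → ‖z (-(i : ℤ))‖ < δ) → ∀ k : ℕ, ‖z (k : ℤ)‖ < r) ∧
    ∀ z : ℤ → ι → ℝ, IsImplicitSolution J A An Ad dn d z →
      Tendsto (fun k : ℕ => z (k : ℤ)) atTop (𝓝 0) := by
  have key : ∀ z : ℤ → ι → ℝ, IsImplicitSolution J A An Ad dn d z →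
      (∀ k : ℕ, c * ‖z (k : ℤ)‖ ^ 2 ≤ qf S (hist (dM + 1) fun l => z (-(l : ℤ)))) ∧
      Tendsto (fun k : ℕ => z (k : ℤ)) atTop (𝓝 0) := by
    intro z hz
    let H : ℕ → ℕ → ι → ℝ := fun k l => z ((k : ℤ) - (l : ℤ))
    have hshift : ∀ k, (fun l => H (k + 1) (l + 1)) = H k := by
      intro k; funext l; simp only [H]; congr 1; push_cast; ring
    have hH : ∀ k l, H (k + 1) (l + 1) = H k l := fun k l => congrFun (hshift k) l
    obtain ⟨h1, h2⟩ := norm_sq_le_and_tendsto_of_decrease (z := fun k : ℕ => z (k : ℤ))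
      (v := fun k => min (qf S (hist (dM + 1) (H k))) (qf S' (hist (dM + 1) (H k)))) hc
      (fun k => le_min (hS _) (hS' _)) fun k => by
        have e0 : H (k + 1) 0 = z ((k : ℤ) + 1) := by simp [H]
        have e1 : H (k + 1) 1 = z (k : ℤ) := by simp [H]
        have := hdec k (H (k + 1)) (by rw [e0, e1, hH, hH]; exact hz k)
        rwa [hshift, e1] at this
    refine ⟨fun k => (h1 k).trans ((min_le_left _ _).trans_eq ?_), h2⟩
    simp [H]
  refine ⟨fun r hr => ?_, fun z hz => (key z hz).2⟩
  -- An initial value below c r² forces c‖z(k)‖² < c r² for all k. Smallness of the form of S alone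
  -- is enough, as the minimum lies below it.
  obtain ⟨δ, hδ, h⟩ := exists_forall_qf_hist_lt (dM + 1) S (ρ := c * r ^ 2) (by positivity)
  refine ⟨δ, hδ, fun z hz h0 k => ?_⟩
  have h1 := ((key z hz).1 k).trans_lt
    (h (fun l => z (-(l : ℤ))) fun i hi => h0 i (Nat.lt_succ_iff.1 hi))
  exact lt_of_pow_lt_pow_left₀ 2 hr.le (lt_of_mul_lt_mul_left h1 hc.le)

/-- Asymptotic stability is inherited through the change of variables `x = Jᵀ z`. -/
lemma asympStable_of_implicit [DecidableEq ι] {J A An Ad A' An' Ad' : Matrix ι ι ℝ} {dn dM : ℕ}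
    {d : ℕ → ℕ} (hJ : IsUnit J.det) (hA : A' * Jᵀ = A) (hAn : An' * Jᵀ = An)
    (hAd : Ad' * Jᵀ = Ad)
    (hst : (∀ r : ℝ, 0 < r → ∃ δ : ℝ, 0 < δ ∧ ∀ z : ℤ → ι → ℝ,
      IsImplicitSolution J A An Ad dn d z →
      (∀ i : ℕ, i ≤ dM → ‖z (-(i : ℤ))‖ < δ) → ∀ k : ℕ, ‖z (k : ℤ)‖ < r) ∧
      ∀ z : ℤ → ι → ℝ, IsImplicitSolution J A An Ad dn d z →
        Tendsto (fun k : ℕ => z (k : ℤ)) atTop (𝓝 0)) :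
    AsympStable A' An' Ad' dn dM d := by
  have hJT : IsUnit Jᵀ.det := by rwa [Matrix.det_transpose]
  have hinv : ∀ y, Jᵀ *ᵥ (Jᵀ⁻¹ *ᵥ y) = y := fun y => by
    rw [Matrix.mulVec_mulVec, Matrix.mul_nonsing_inv _ hJT, Matrix.one_mulVec]
  have hsol : ∀ x, IsSolution A' An' Ad' dn d x →
      IsImplicitSolution J A An Ad dn d fun k => Jᵀ⁻¹ *ᵥ x k := by
    intro x hx k
    simp only [← hA, ← hAn, ← hAd, ← Matrix.mulVec_mulVec, hinv]
    exact hx k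
  constructor
  · intro r hr
    obtain ⟨ρ, hρ, h1⟩ := exists_forall_norm_mulVec_lt Jᵀ hr
    obtain ⟨δ, hδ, h2⟩ := hst.1 ρ hρ
    obtain ⟨δ', hδ', h3⟩ := exists_forall_norm_mulVec_lt Jᵀ⁻¹ hδ
    refine ⟨δ', hδ', fun x hx h0 k => ?_⟩
    rw [← hinv (x k)]
    exact h1 _ (h2 _ (hsol x hx) (fun i hi => h3 _ (h0 i hi)) k)
  · intro x hx
    have h1 := hst.2 _ (hsol x hx)
    have h2 : Continuous fun y : ι → ℝ => Jᵀ *ᵥ y := by fun_prop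
    have h3 := (h2.tendsto 0).comp h1
    simpa [Function.comp_def, hinv] using h3

end Stability

/-! ### From the augmented state to the plant and observer states -/

section Loop

variable {p q : Type*} [Fintype p] [Fintype q]

/-- Eliminate u, y and e_y. In the error equation the input cancels, and e_y(k) = x_p(k-d(k)) -
x_p(k-d_n) + e(k-d_n). -/
lemma isSolution_of_isLoopSolution {Ap : Matrix p p ℝ} {Bp : Matrix p q ℝ} {K F : Matrix q p ℝ}
    {L : Matrix p p ℝ} {dn : ℕ} {d : ℕ → ℕ} {xp xh : ℤ → p → ℝ}
    (h : IsLoopSolution Ap Bp K F L dn d xp xh) :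
    IsSolution (clA Ap Bp K) (clAn Bp F L) (clAd Bp F L) dn d
      fun k => Sum.elim (xp k) (xp k - xh k) := by
  obtain ⟨u, y, ey, h⟩ := h
  intro k
  obtain ⟨h1, h2, h3, h4, h5⟩ := h k
  simp only [clA, clAn, clAd, Matrix.fromBlocks_mulVec, Sum.elim_comp_inl, Sum.elim_comp_inr]
  rw [h1, h3, h4, h5, h2]
  ext (i | i)
  · simp only [Matrix.mulVec_add, Matrix.mulVec_sub, Matrix.add_mulVec, Matrix.neg_mulVec,
      ← Matrix.mulVec_mulVec, Matrix.zero_mulVec, Pi.add_apply, Sum.elim_inl, Pi.sub_apply,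
      Pi.neg_apply, Pi.zero_apply]
    ring
  · simp only [Matrix.mulVec_add, Matrix.mulVec_sub, Matrix.neg_mulVec, Matrix.zero_mulVec,
      Pi.add_apply, Sum.elim_inr, Pi.sub_apply, Pi.neg_apply, Pi.zero_apply]
    ring

lemma norm_le_norm_sumElim_left (a b : p → ℝ) : ‖a‖ ≤ ‖(Sum.elim a b : p ⊕ p → ℝ)‖ :=
  (pi_norm_le_iff_of_nonneg (norm_nonneg _)).2 fun r => norm_le_pi_norm (Sum.elim a b) (Sum.inl r)

lemma norm_le_norm_sumElim_right (a b : p → ℝ) : ‖b‖ ≤ ‖(Sum.elim a b : p ⊕ p → ℝ)‖ :=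
  (pi_norm_le_iff_of_nonneg (norm_nonneg _)).2 fun r => norm_le_pi_norm (Sum.elim a b) (Sum.inr r)

lemma loopAsympStable_of_asympStable {Ap : Matrix p p ℝ} {Bp : Matrix p q ℝ} {K F : Matrix q p ℝ}
    {L : Matrix p p ℝ} {dn dM : ℕ} {d : ℕ → ℕ}
    (h : AsympStable (clA Ap Bp K) (clAn Bp F L) (clAd Bp F L) dn dM d) :
    LoopAsympStable Ap Bp K F L dn dM d := by
  constructor
  · intro r hr
    -- The halves pay for the triangle inequality in passing from x̂_p to the error and back.
    obtain ⟨δ, hδ, hx⟩ := h.1 (r / 2) (by positivity)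
    refine ⟨δ / 2, by positivity, fun xp xh hs h0 k => ?_⟩
    have h1 := hx _ (isSolution_of_isLoopSolution hs) (fun i hi => by
      obtain ⟨hp, hh⟩ := h0 i hi
      rw [pi_norm_lt_iff hδ]
      rintro (j | j)
      · exact (norm_le_pi_norm (xp _) j).trans_lt (by linarith)
      · refine (norm_le_pi_norm (xp _ - xh _) j).trans_lt ((norm_sub_le _ _).trans_lt ?_)
        linarith) k
    have h2 := (norm_le_norm_sumElim_left (xp k) (xp k - xh k)).trans_lt h1
    have h3 := (norm_le_norm_sumElim_right (xp k) (xp k - xh k)).trans_lt h1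
    refine ⟨by linarith, ?_⟩
    calc ‖xh k‖ = ‖xp k - (xp k - xh k)‖ := by rw [sub_sub_cancel]
      _ ≤ ‖xp k‖ + ‖xp k - xh k‖ := norm_sub_le _ _
      _ < r := by linarith
  · intro xp xh hs
    have h1 := tendsto_pi_nhds.1 (h.2 _ (isSolution_of_isLoopSolution hs))
    have hp : Tendsto (fun k : ℕ => xp (k : ℤ)) atTop (𝓝 0) :=
      tendsto_pi_nhds.2 fun i => h1 (Sum.inl i)
    have he : Tendsto (fun k : ℕ => xp (k : ℤ) - xh (k : ℤ)) atTop (𝓝 0) :=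
      tendsto_pi_nhds.2 fun i => h1 (Sum.inr i)
    exact ⟨hp, by simpa using hp.sub he⟩

end Loop

/-! ### Recovering the gains, and invertibility of U -/

section Gains

variable {p q : Type*} [Fintype p] [Fintype q]

/-- The same block U stands twice in J, so each gain meets only Uᵀ and the product is linear in the
barred variables. -/
lemma clA_mul_transpose_matJ {Ap U : Matrix p p ℝ} {Bp : Matrix p q ℝ} {K Kb : Matrix q p ℝ}
    (hK : K * Uᵀ = Kb) : clA Ap Bp K * (matJ U)ᵀ = barA Ap Bp U Kb := by
  simp [clA, matJ, barA, Matrix.fromBlocks_transpose, Matrix.fromBlocks_multiply, Matrix.add_mul,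
    Matrix.mul_assoc, hK]

lemma clAd_mul_transpose_matJ {U L Lb : Matrix p p ℝ} {Bp : Matrix p q ℝ} {F Fb : Matrix q p ℝ}
    (hF : F * Uᵀ = Fb) (hL : L * Uᵀ = Lb) : clAd Bp F L * (matJ U)ᵀ = clAd Bp Fb Lb := by
  simp [clAd, matJ, Matrix.fromBlocks_transpose, Matrix.fromBlocks_multiply, Matrix.mul_assoc,
    hF, hL]

lemma clAn_mul_transpose_matJ {U L Lb : Matrix p p ℝ} {Bp : Matrix p q ℝ} {F Fb : Matrix q p ℝ}
    (hF : F * Uᵀ = Fb) (hL : L * Uᵀ = Lb) : clAn Bp F L * (matJ U)ᵀ = clAn Bp Fb Lb := by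
  simp [clAn, matJ, Matrix.fromBlocks_transpose, Matrix.fromBlocks_multiply, Matrix.mul_assoc,
    hF, hL]

lemma det_matJ [DecidableEq p] (U : Matrix p p ℝ) : (matJ U).det = U.det * U.det := by
  rw [matJ, Matrix.det_fromBlocks_zero₂₁]

/-- The block of `Φ(d, 2) + Ῡ₂` at `x(k+1)` forces `J` to be invertible. -/
lemma isUnit_det_of_negDef_phiMode2 {ι : Type*} [Fintype ι] [DecidableEq ι] {dn dM d : ℕ} {ε : ℝ}
    {P : Matrix (Fin 3 × ι) (Fin 3 × ι) ℝ} {Q1 Q2 Z1 Z2 : Matrix ι ι ℝ}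
    {Y : Matrix (Fin 2 × ι) (Fin 2 × ι) ℝ} {J A Am Ad AM : Matrix ι ι ℝ} (hP : P.PosSemidef)
    (hZ1 : Z1.PosSemidef) (hZ2 : Z2.PosSemidef)
    (h : NegDef (phiMode2 dn dM P Q1 Q2 Z1 Z2 Y d + upsilon 8 ε J A Am Ad AM)) :
    IsUnit J.det := by
  rw [isUnit_iff_ne_zero]
  intro h0
  rw [← Matrix.det_transpose] at h0
  obtain ⟨w, hw, hJw⟩ := Matrix.exists_mulVec_eq_zero_iff.2 h0
  -- On this vector every subtracted term of Φ vanishes, leaving nonnegative terms in P, Z₁ and Z₂;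
  -- Ῡ contributes only a multiple of wᵀJᵀw = 0.
  let X : Fin 8 → ι → ℝ := ![w, 0, 0, 0, 0, 0, 0, 0]
  have hX : vec X ≠ 0 := fun hX => hw (funext fun r => congrFun hX (0, r))
  have h1 := qf_pos h hX
  rw [qf_neg_left, qf_add_left, qf_phiMode2 dn dM hP] at h1
  have hU : qf (upsilon 8 ε J A Am Ad AM) (vec X) = 0 := by
    refine (qf_upsilon 3 ε J A Am Ad AM X).trans ?_
    have : -(Jᵀ *ᵥ w) + A *ᵥ 0 + Am *ᵥ 0 + Ad *ᵥ 0 + AM *ᵥ 0 = 0 := by simp [hJw]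
    refine (congrArg (fun y => 2 * ((w + ε • 0) ⬝ᵥ y)) this).trans ?_
    simp
  have h2 := qf_nonneg hP (vec (comb (w2 dn dM + wd d) X))
  have h3 : comb (w1 dn dM + wd d) X = 0 := by
    funext i
    fin_cases i <;> simp [comb, X, w1, wd, Fin.sum_univ_eight]
  have h4 : (Sum.elim (vec ![0, 0]) (vec ![0, 0]) : (Fin 2 × ι) ⊕ (Fin 2 × ι) → ℝ) = 0 := by
    ext (⟨i, r⟩ | ⟨i, r⟩) <;> fin_cases i <;> rfl
  have h5 := mul_nonneg (sq_nonneg (dn : ℝ)) (qf_nonneg hZ1 w)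
  have h6 := mul_nonneg (sq_nonneg ((dM : ℝ) - dn)) (qf_nonneg hZ2 w)
  rw [hU, h3] at h1
  simp only [X, Matrix.cons_val, sub_zero, add_zero, smul_zero, qf_zero, mul_zero, vec_zero, h4]
    at h1 h2
  linarith

end Gains

end DelayLMI

end

/-! ### The stability theorem -/

open DelayLMI
theorem corollary1 (np m : ℕ) (dm dn dM : ℕ) (hdm : 1 ≤ dm) (hmn : dm ≤ dn) (hnM : dn ≤ dM)
    (Ap : Matrix (Fin np) (Fin np) ℝ) (Bp : Matrix (Fin np) (Fin m) ℝ) (ε : ℝ)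
    -- decision matrices of the first mode
    (P1 : Matrix (Fin 4 × (Fin np ⊕ Fin np)) (Fin 4 × (Fin np ⊕ Fin np)) ℝ)
    (Q11 Q21 Q31 Z11 Z21 Z31 : Matrix (Fin np ⊕ Fin np) (Fin np ⊕ Fin np) ℝ)
    (X1 : Matrix (Fin 2 × (Fin np ⊕ Fin np)) (Fin 2 × (Fin np ⊕ Fin np)) ℝ)
    -- decision matrices of the second mode
    (P2 : Matrix (Fin 3 × (Fin np ⊕ Fin np)) (Fin 3 × (Fin np ⊕ Fin np)) ℝ)
    (Q12 Q22 Z12 Z22 : Matrix (Fin np ⊕ Fin np) (Fin np ⊕ Fin np) ℝ)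
    (X2 : Matrix (Fin 2 × (Fin np ⊕ Fin np)) (Fin 2 × (Fin np ⊕ Fin np)) ℝ)
    -- common decision matrices
    (U : Matrix (Fin np) (Fin np) ℝ) (Kb Fb : Matrix (Fin m) (Fin np) ℝ)
    (Lb : Matrix (Fin np) (Fin np) ℝ)
    (hP1 : P1.PosDef) (hQ11 : Q11.PosDef) (hQ21 : Q21.PosDef) (hQ31 : Q31.PosDef)
    (hZ11 : Z11.PosDef) (hZ21 : Z21.PosDef) (hZ31 : Z31.PosDef)
    (hP2 : P2.PosDef) (hQ12 : Q12.PosDef) (hQ22 : Q22.PosDef)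
    (hZ12 : Z12.PosDef) (hZ22 : Z22.PosDef)
    -- main inequalities, first mode
    (hPsi1 : (psiZ Z21 X1).PosDef)
    (hPhi1m : NegDef (phiMode1 dm dn dM P1 Q11 Q21 Q31 Z11 Z21 Z31 X1 dm +
      upsilon 10 ε (matJ U) (barA Ap Bp U Kb) 0 (clAd Bp Fb Lb) (clAn Bp Fb Lb)))
    (hPhi1M : NegDef (phiMode1 dm dn dM P1 Q11 Q21 Q31 Z11 Z21 Z31 X1 dn +
      upsilon 10 ε (matJ U) (barA Ap Bp U Kb) 0 (clAd Bp Fb Lb) (clAn Bp Fb Lb)))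
    -- main inequalities, second mode
    (hPsi2 : (psiZ Z22 X2).PosDef)
    (hPhi2m : NegDef (phiMode2 dn dM P2 Q12 Q22 Z12 Z22 X2 dn +
      upsilon 8 ε (matJ U) (barA Ap Bp U Kb) (clAn Bp Fb Lb) (clAd Bp Fb Lb) 0))
    (hPhi2M : NegDef (phiMode2 dn dM P2 Q12 Q22 Z12 Z22 X2 dM +
      upsilon 8 ε (matJ U) (barA Ap Bp U Kb) (clAn Bp Fb Lb) (clAd Bp Fb Lb) 0))
    -- inequalities linking the two modes
    (hEdge1 : ∀ l : ℕ, dm ≤ l → l ≤ dn → NegDef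
      (edge (sOne dm dn dM P1 Q11 Q21 Q31 Z11 Z21 Z31) (sTwo dn dM P2 Q12 Q22 Z12 Z22) +
        He ((multI (Fin np ⊕ Fin np) dM ε)ᵀ *
          barL dn dM (matJ U) (barA Ap Bp U Kb) (clAn Bp Fb Lb) (clAd Bp Fb Lb) l)))
    (hEdge2 : ∀ l : ℕ, dn ≤ l → l ≤ dM → NegDef
      (edge (sTwo dn dM P2 Q12 Q22 Z12 Z22) (sOne dm dn dM P1 Q11 Q21 Q31 Z11 Z21 Z31) +
        He ((multI (Fin np ⊕ Fin np) dM ε)ᵀ *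
          barL dn dM (matJ U) (barA Ap Bp U Kb) (clAn Bp Fb Lb) (clAd Bp Fb Lb) l))) :
    IsUnit U.det ∧
    ∀ K F : Matrix (Fin m) (Fin np) ℝ, ∀ L : Matrix (Fin np) (Fin np) ℝ,
      K = Kb * (U⁻¹)ᵀ → F = Fb * (U⁻¹)ᵀ → L = Lb * (U⁻¹)ᵀ →
      ∀ d : ℕ → ℕ, (∀ k, dm ≤ d k ∧ d k ≤ dM) →
        AsympStable (clA Ap Bp K) (clAn Bp F L) (clAd Bp F L) dn dM d ∧
        LoopAsympStable Ap Bp K F L dn dM d := by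
  have sym : ∀ {Z : Matrix (Fin np ⊕ Fin np) (Fin np ⊕ Fin np) ℝ}, Z.PosDef → Zᵀ = Z :=
    fun hZ => by simpa using hZ.isHermitian.eq
  have hJ := isUnit_det_of_negDef_phiMode2 hP2.posSemidef hZ12.posSemidef hZ22.posSemidef hPhi2m
  have hU : IsUnit U.det := by
    rw [det_matJ] at hJ
    exact isUnit_of_mul_isUnit_left hJ
  refine ⟨hU, ?_⟩
  rintro K F L hK hF hL d hd
  have cancel : ∀ {r : ℕ} {G Gb : Matrix (Fin r) (Fin np) ℝ}, G = Gb * (U⁻¹)ᵀ → G * Uᵀ = Gb := by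
    intro r G Gb h
    rw [h, Matrix.mul_assoc, ← Matrix.transpose_mul, Matrix.mul_nonsing_inv _ hU,
      Matrix.transpose_one, Matrix.mul_one]
  obtain ⟨c₁, hc₁, h₁⟩ := exists_lyapOne_decrease hnM hP1.posSemidef hQ31.posSemidef
    hZ11.posSemidef hZ21.posSemidef hZ31.posSemidef hPsi1.posSemidef hPhi1m hPhi1M
  obtain ⟨c₂, hc₂, h₂⟩ := exists_lyapTwo_decrease hP2.posSemidef hZ12.posSemidef hZ22.posSemidef
    hPsi2.posSemidef hPhi2m hPhi2M
  obtain ⟨c₃, hc₃, h₃⟩ := exists_edge_decrease hnM hnM hEdge1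
  obtain ⟨c₄, hc₄, h₄⟩ := exists_edge_decrease hnM le_rfl hEdge2
  have e₁ := qf_sOne hmn hnM P1 Q11 Q21 Q31 (sym hZ11) (sym hZ21) (sym hZ31)
  have e₂ := qf_sTwo hnM P2 Q12 Q22 (sym hZ12) (sym hZ22)
  have hst : AsympStable (clA Ap Bp K) (clAn Bp F L) (clAd Bp F L) dn dM d := by
    refine asympStable_of_implicit hJ (clA_mul_transpose_matJ (cancel hK))
      (clAn_mul_transpose_matJ (cancel hF) (cancel hL))
      (clAd_mul_transpose_matJ (cancel hF) (cancel hL))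
      (implicit_asympStable (c := min (min c₁ c₂) (min c₃ c₄))
        (lt_min (lt_min hc₁ hc₂) (lt_min hc₃ hc₄))
        (sOne dm dn dM P1 Q11 Q21 Q31 Z11 Z21 Z31) (sTwo dn dM P2 Q12 Q22 Z12 Z22)
        (fun h => ?_) (fun h => ?_) fun k g hg => ?_)
    · rw [e₁]
      exact lyapOne_nonneg hmn hnM hP1.posSemidef hQ11.posSemidef hQ21.posSemidef
        hQ31.posSemidef hZ11.posSemidef hZ21.posSemidef hZ31.posSemidef h
    · rw [e₂]
      exact lyapTwo_nonneg hnM hP2.posSemidef hQ12.posSemidef hQ22.posSemidef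
        hZ12.posSemidef hZ22.posSemidef h
    · have hle : ∀ c, min (min c₁ c₂) (min c₃ c₄) ≤ c →
          min (min c₁ c₂) (min c₃ c₄) * ‖g 1‖ ^ 2 ≤ c * ‖g 1‖ ^ 2 :=
        fun c hc => mul_le_mul_of_nonneg_right hc (sq_nonneg _)
      have l₁ := hle c₁ ((min_le_left _ _).trans (min_le_left _ _))
      have l₂ := hle c₂ ((min_le_left _ _).trans (min_le_right _ _))
      have l₃ := hle c₃ ((min_le_right _ _).trans (min_le_left _ _))
      have l₄ := hle c₄ ((min_le_right _ _).trans (min_le_right _ _))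
      rw [le_sub_iff_add_le, le_min_iff]
      -- The current delay selects the functional that is small after the step. Its own decrease and
      -- the linking inequality put it below both previous values; at d(k) = d_n either choice
      -- works.
      rcases le_total (d k) dn with hk | hk
      · have a₁ := h₁ (d k) (hd k).1 hk g hg
        have a₃ := h₃ (d k) (hd k).1 hk g hg
        rw [← e₁, ← e₁] at a₁
        constructor <;>
          linarith [min_le_left (qf (sOne dm dn dM P1 Q11 Q21 Q31 Z11 Z21 Z31) (hist (dM + 1) g))
            (qf (sTwo dn dM P2 Q12 Q22 Z12 Z22) (hist (dM + 1) g))]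
      · have a₂ := h₂ (d k) hk (hd k).2 g hg
        have a₄ := h₄ (d k) hk (hd k).2 g hg
        rw [← e₂, ← e₂] at a₂
        constructor <;>
          linarith [min_le_right (qf (sOne dm dn dM P1 Q11 Q21 Q31 Z11 Z21 Z31) (hist (dM + 1) g))
            (qf (sTwo dn dM P2 Q12 Q22 Z12 Z22) (hist (dM + 1) g))]
  exact ⟨hst, loopAsympStable_of_asympStable hst⟩
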